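/- Setting. Let $n,q,\lambda$ be integers with $1\le q\le n$ and $\lambda\ge 1$. A systematic probabilistic batch code (PBC) consists of four probabilistic algorithms, each given $n,q,\lambda$ and each always halting within a number of steps polynomial in $n+\lambda$: - $\mathsf{Init}$ outputs parameters $\mathsf{prms}$. - $\mathsf{Encode}(\mathsf{prms},\mathsf{DB})$ maps a database $\mathsf{DB}$ of $n$ entries to $m$ buckets $(C_1,\dots,C_m)$, each a list of codewords, where every codeword is one of the $n$ entries of $\mathsf{DB}$. - $\mathsf{Schedule}(\mathsf{prms},Q)$ maps a query $Q$ of $q$ distinct elements of $[n]$ to $(S_1,\dots,S_m)$, where $S_i$ is a set of positions in the bucket $C_i$. - $\mathsf{Decode}(\mathsf{prms},Q,((C_i)_j)_{j\in S_i,\,1\le i\le m})$ outputs a list $R$ of entries, which should be $(\mathsf{DB}_i)_{i\in Q}$. It is an $(n,N,q,m,t)$-systematic PBC if, for all outcomes of the random choices, all databases and all queries, the $m$ buckets contain at most $N$ codewords in total and $|S_i|\le t$ for all $i$. It is $\varepsilon$-robust if for every probabilistic polynomial-time (in $n+\lambda$) adversary $\mathcal A$ that is given $n,q,\lambda$ and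 $\mathsf{prms}\leftarrow\mathsf{Init}$ and outputs a database $\mathsf{DB}$ of $n$ entries and a query $Q$ of $q$ distinct elements of $[n]$, $$\Pr\bigl[R\ne(\mathsf{DB}_i)_{i\in Q}\bigr]\le\varepsilon ,$$ where $R$ is obtained by running $\mathsf{Encode}(\mathsf{prms},\mathsf{DB})$, $\mathsf{Schedule}(\mathsf{prms},Q)$ and $\mathsf{Decode}$, and the probability is over $\mathsf{Init}$, $\mathcal A$ and the other algorithms (an adversary without a valid output does not win). Theorem. For every function $f:\mathbb N\to[0,\infty)$ with $f(n)=\omega(\log n)$ there is a PBC (four algorithms that are uniform in $n,q,\lambda$) which, for all $1\le q\le n$ and $\lambda\ge1$, is an $(n,N,q,b,1)$-systematic PBC that is $2^{-\lambda}$-robust, where $$b=O(q)\qquad\text{and}\qquad N=O\bigl(n\,(f(n)+\lambda)\bigr).$$ The constant in $b=O(q)$ is absolute, and the constant in the bound on $N$ depends only on $f$. -/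

import Mathlib

open Filter Asymptotics
open scoped ENNReal Polynomial

noncomputable section

namespace RobustPBC

/-! ## A probabilistic random access machine with unit step cost

Programs of a structured imperative language. A state has number registers, a read-only bank of
input arrays and a read-write bank of dynamically growing work arrays. The arithmetic operations
are addition and truncated subtraction only, so the bit lengths of all numbers grow at most
linearly with the number of steps, and polynomially many steps of this machine are polynomial
time in the usual sense. -/

/-- Expressions: constants, registers, sums, truncated differences, and the lengths and entries
of input arrays and of work arrays (the array is chosen by its computed number). -/
inductive Expr where
  | const (v : ℕ)
  | reg (x : ℕ)
  | add (e₁ e₂ : Expr)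
  | sub (e₁ e₂ : Expr)
  | inLen (a : Expr)
  | inGet (a i : Expr)
  | len (a : Expr)
  | get (a i : Expr)

/-- Programs. Conditions are expressions, read as true when their value is not zero. -/
inductive Cmd where
  | skip
  | assign (x : ℕ) (e : Expr)
  | push (a e : Expr)
  | store (a i e : Expr)
  | flip (x : ℕ)
  | seq (c d : Cmd)
  | ite (e : Expr) (c d : Cmd)
  | loop (e : Expr) (c : Cmd)

/-- Machine states. -/
structure State where
  inp : List (List ℕ)
  reg : ℕ → ℕ
  arr : ℕ → List ℕ

/-- The state in which a program starts: all registers are zero, all work arrays are empty. -/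
def State.start (inp : List (List ℕ)) : State where
  inp := inp
  reg := fun _ => 0
  arr := fun _ => []

def State.setReg (s : State) (x v : ℕ) : State :=
  { s with reg := Function.update s.reg x v }

def State.setArr (s : State) (a : ℕ) (l : List ℕ) : State :=
  { s with arr := Function.update s.arr a l }

/-- The value of an expression. An access outside the bounds of an array gives `0`. -/
def Expr.eval (s : State) : Expr → ℕ
  | .const v => v
  | .reg x => s.reg x
  | .add e₁ e₂ => e₁.eval s + e₂.eval s
  | .sub e₁ e₂ => e₁.eval s - e₂.eval s
  | .inLen a => (s.inp.getD (a.eval s) []).length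
  | .inGet a i => (s.inp.getD (a.eval s) []).getD (i.eval s) 0
  | .len a => (s.arr (a.eval s)).length
  | .get a i => (s.arr (a.eval s)).getD (i.eval s) 0

/-- `run T K s` is the distribution of the final state when the commands in the list `K` are
executed one after the other from state `s`, with at most `T` steps; `none` means that the
execution needs more than `T` steps. Every assignment, array update, coin toss, evaluation of a
condition and unfolding of a composition is one step. The command `flip x` puts a fair coin
toss, independent of everything before, into register `x`. -/
def run : ℕ → List Cmd → State → PMF (Option State)
  | _, [], s => PMF.pure (some s)
  | 0, _ :: _, _ => PMF.pure none
  | T + 1, .skip :: K, s => run T K s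
  | T + 1, .assign x e :: K, s => run T K (s.setReg x (e.eval s))
  | T + 1, .push a e :: K, s =>
      run T K (s.setArr (a.eval s) (s.arr (a.eval s) ++ [e.eval s]))
  | T + 1, .store a i e :: K, s =>
      run T K (s.setArr (a.eval s) ((s.arr (a.eval s)).set (i.eval s) (e.eval s)))
  | T + 1, .flip x :: K, s =>
      (PMF.uniformOfFintype Bool).bind fun β => run T K (s.setReg x β.toNat)
  | T + 1, .seq c d :: K, s => run T (c :: d :: K) s
  | T + 1, .ite e c d :: K, s =>
      if e.eval s ≠ 0 then run T (c :: K) s else run T (d :: K) s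
  | T + 1, .loop e c :: K, s =>
      if e.eval s ≠ 0 then run T (c :: .loop e c :: K) s else run T K s

/-- The distribution of the work arrays after at most `T` steps of `c` on the input arrays
`inp`; `none` if `c` has not halted by then. -/
def Cmd.exec (c : Cmd) (T : ℕ) (inp : List (List ℕ)) : PMF (Option (ℕ → List ℕ)) :=
  (run T [c] (State.start inp)).map (Option.map State.arr)

/-! ## Probabilistic batch codes -/

/-- Admissible parameters: `n` database entries, queries of `q` entries, security parameter
`lam`. -/
def Admissible (n q lam : ℕ) : Prop := 1 ≤ q ∧ q ≤ n ∧ 1 ≤ lam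

/-- Databases of `n` entries. -/
def IsDatabase (n : ℕ) (DB : List ℕ) : Prop := DB.length = n

/-- Queries: `q` distinct elements of `{0, …, n - 1}`. -/
def IsQuery (n q : ℕ) (Q : List ℕ) : Prop := Q.length = q ∧ Q.Nodup ∧ ∀ x ∈ Q, x < n

/-- The requested entries, in the order of the query. -/
def answers (DB Q : List ℕ) : List ℕ := Q.map fun x => DB.getD x 0

/-- The codewords that are read from the buckets `C` by the schedule `S`. -/
def reads (S C : List (List ℕ)) : List (List ℕ) :=
  List.zipWith (fun s c => s.map fun j => c.getD j 0) S C

/-- The four algorithms of a batch code, uniform in `n`, `q` and `lam`, with a polynomial that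
bounds the number of steps of each of them as a function of `n + lam`. -/
structure Code where
  initP : Cmd
  encodeP : Cmd
  scheduleP : Cmd
  decodeP : Cmd
  time : ℕ[X]

namespace Code

/-- The number of steps that the algorithms are given. -/
def clock (P : Code) (n lam : ℕ) : ℕ := P.time.eval (n + lam)

/-- `Init`: the parameters are the final content of work array `0`. -/
def init (P : Code) (n q lam : ℕ) : PMF (Option (List ℕ)) :=
  (P.initP.exec (P.clock n lam) [[n, q, lam]]).map (Option.map fun r => r 0)

/-- `Encode`, with `m` buckets: they are the final contents of work arrays `0, …, m - 1`. -/
def encode (P : Code) (n q lam m : ℕ) (prms DB : List ℕ) : PMF (Option (List (List ℕ))) :=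
  (P.encodeP.exec (P.clock n lam) [[n, q, lam], prms, DB]).map
    (Option.map fun r => (List.range m).map r)

/-- `Schedule`, for `m` buckets: the lists of positions to read in the buckets are the final
contents of work arrays `0, …, m - 1`. -/
def schedule (P : Code) (n q lam m : ℕ) (prms Q : List ℕ) : PMF (Option (List (List ℕ))) :=
  (P.scheduleP.exec (P.clock n lam) [[n, q, lam], prms, Q]).map
    (Option.map fun r => (List.range m).map r)

/-- `Decode`, on the parameters, the query and, for each bucket, the scheduled positions and the
codewords at these positions. The output is the final content of work array `0`. -/
def decode (P : Code) (n q lam : ℕ) (prms Q : List ℕ) (S D : List (List ℕ)) :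
    PMF (Option (List ℕ)) :=
  (P.decodeP.exec (P.clock n lam)
    ([n, q, lam] :: prms :: Q :: (List.zipWith (fun s d => [s, d]) S D).flatten)).map
    (Option.map fun r => r 0)

/-- `P` is, for all admissible `n`, `q` and `lam`, an `(n, N, q, m, t)`-systematic batch code
(where `N` and `m` may depend on `n`, `q` and `lam`): its algorithms always halt in polynomial
time; there are at most `N` codewords in the `m` buckets and all of them are database entries;
and a schedule consists of at most `t` existing positions of each bucket. -/
def IsSystematic (P : Code) (N m : ℕ → ℕ → ℕ → ℕ) (t : ℕ) : Prop :=
  ∀ n q lam : ℕ, Admissible n q lam →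
    none ∉ (P.init n q lam).support ∧
    ∀ prms : List ℕ, some prms ∈ (P.init n q lam).support →
      ∀ DB Q : List ℕ, IsDatabase n DB → IsQuery n q Q →
        none ∉ (P.encode n q lam (m n q lam) prms DB).support ∧
        none ∉ (P.schedule n q lam (m n q lam) prms Q).support ∧
        (∀ C : List (List ℕ), some C ∈ (P.encode n q lam (m n q lam) prms DB).support →
          (C.map List.length).sum ≤ N n q lam ∧ ∀ c ∈ C, ∀ x ∈ c, x ∈ DB) ∧
        (∀ S : List (List ℕ), some S ∈ (P.schedule n q lam (m n q lam) prms Q).support →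
          ∀ s ∈ S, s.Nodup ∧ s.length ≤ t) ∧
        (∀ C S : List (List ℕ),
          some C ∈ (P.encode n q lam (m n q lam) prms DB).support →
          some S ∈ (P.schedule n q lam (m n q lam) prms Q).support →
            (∀ i < m n q lam, ∀ j ∈ S.getD i [], j < (C.getD i []).length) ∧
            none ∉ (P.decode n q lam prms Q S (reads S C)).support)

end Code

/-- Probabilistic polynomial-time adversaries: a program with a polynomial step bound. -/
structure Adversary where
  prog : Cmd
  time : ℕ[X]

/-- The adversary is given `n`, `q`, `lam` and the parameters of the code. It outputs a database
(work array `0`) and a query (work array `1`); it is stopped without output when its polynomial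
number of steps is exceeded. -/
def Adversary.attack (A : Adversary) (n q lam : ℕ) (prms : List ℕ) :
    PMF (Option (List ℕ × List ℕ)) :=
  (A.prog.exec (A.time.eval (n + lam)) [[n, q, lam], prms]).map
    (Option.map fun r => (r 0, r 1))

namespace Code

open Classical in
/-- Whether encoding `DB`, scheduling `Q` and decoding gives a wrong result. -/
def errs (P : Code) (n q lam m : ℕ) (prms DB Q : List ℕ) : PMF Bool :=
  (P.encode n q lam m prms DB).bind fun C? =>
    (P.schedule n q lam m prms Q).bind fun S? =>
      match C?, S? with
      | some C, some S =>
          (P.decode n q lam prms Q S (reads S C)).map fun R? =>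
            decide (R? ≠ some (answers DB Q))
      | _, _ => PMF.pure true

open Classical in
/-- The robustness experiment; its outcome is `true` when the adversary, knowing the parameters,
has output a database of `n` entries and a query of `q` distinct entries on which the code
errs. -/
def game (P : Code) (A : Adversary) (n q lam m : ℕ) : PMF Bool :=
  (P.init n q lam).bind fun prms? =>
    match prms? with
    | none => PMF.pure true
    | some prms =>
        (A.attack n q lam prms).bind fun out? =>
          match out? with
          | none => PMF.pure false
          | some (DB, Q) =>
              if IsDatabase n DB ∧ IsQuery n q Q then P.errs n q lam m prms DB Q
              else PMF.pure false

/-- `ε`-robustness of a batch code with `m` buckets: no probabilistic polynomial-time adversary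
finds an erring query with probability more than `ε`. -/
def IsRobust (P : Code) (m : ℕ → ℕ → ℕ → ℕ) (ε : ℕ → ℝ≥0∞) : Prop :=
  ∀ A : Adversary, ∀ n q lam : ℕ, Admissible n q lam →
    P.game A n q lam (m n q lam) true ≤ ε lam

end Code

end RobustPBC

end

open Filter Asymptotics
open scoped ENNReal Polynomial

set_option linter.unusedSimpArgs false

namespace RobustPBC

/-! Each item gets at least 3(log n + λ) random edges to 2^`bucketBits q` buckets, a power of two
that is at least 4q and below 8q. Every edge stores one copy of its item in its bucket, so edges and
codewords are the same thing. One read per bucket answers a query as soon as its items are matched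
to distinct buckets along edges. By Hall, this can fail only if some s ≤ q items have all their
edges inside some s buckets. A single edge falls into s given buckets with probability at most 1/4,
so a fixed pair of sets is bad with probability at most 4^(-3(log n + λ)s). This outweighs the
number of pairs, and the union bound gives 2^(-λ) (`samples_not_isGood_le`). The bound covers all
queries simultaneously, so knowing the parameters does not help an adversary, whatever its power
(`isRobust_auctionCode`).

The matching has to be found in polynomial time on a machine that only adds and subtracts. An
auction does this: an unassigned item takes its cheapest neighbouring bucket, raises the price by
one and evicts the owner. Every assigned item then pays at most one more than the price of any of
its neighbours, and under Hall's condition this keeps all prices at most q + 1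
(`AuctionInv.price_le`). Until the auction is complete, each round raises a price or loads an item,
so 8q(q + 2) rounds suffice (`AuctionState.exists_owner`). The number of rounds is fixed in advance
and the other invariants need no Hall condition. Hence halting and the systematic format hold for
all parameters, and only correctness depends on a good table.

The code does not depend on `f`; the growth assumption is used only to compare log n with `f n`
(`exists_edges_le`). The lemmas named `runs...` verify the programs by loop invariants, with step
counts. -/

/-! ## Step-counting program logic -/

/-- From state `s` the command `c` takes exactly `t` steps and ends in a state distributed
according to `μ`. -/
def RunsIn (c : Cmd) (s : State) (t : ℕ) (μ : PMF State) : Prop :=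
  -- Quantifying over the remaining budget and the remaining commands makes the notion
  -- compositional. One exact `t` serves all coin outcomes, since the continuation gets the same
  -- budget `T` on every branch.
  ∀ T K, run (T + t) (c :: K) s = μ.bind fun s' => run T K s'

/-- From state `s` the command `c` ends in the state `s'` after at most `t` steps. -/
def Runs (c : Cmd) (s s' : State) (t : ℕ) : Prop :=
  ∃ t' ≤ t, RunsIn c s t' (PMF.pure s')

theorem Runs.mono {c : Cmd} {s s' : State} {t t' : ℕ} (h : Runs c s s' t) (ht : t ≤ t') :
    Runs c s s' t' :=
  let ⟨u, hu, h⟩ := h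
  ⟨u, hu.trans ht, h⟩

theorem RunsIn.seq {c d : Cmd} {s s' : State} {t t' : ℕ} {μ : PMF State}
    (hc : RunsIn c s t (PMF.pure s')) (hd : RunsIn d s' t' μ) :
    RunsIn (.seq c d) s (t + t' + 1) μ := by
  intro T K
  have : T + (t + t' + 1) = (T + t' + t) + 1 := by omega
  rw [this, run, hc, PMF.pure_bind, hd]

/-- Random intermediate states are indexed by the outcome `a`, so that a specification of `d` is
needed only on the states `σ a`. -/
theorem RunsIn.seq_bind {c d : Cmd} {s : State} {α : Type} {ν : PMF α} {σ : α → State}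
    {t t' : ℕ} {μ : α → PMF State}
    (hc : RunsIn c s t (ν.map σ)) (hd : ∀ a, RunsIn d (σ a) t' (μ a)) :
    RunsIn (.seq c d) s (t + t' + 1) (ν.bind μ) := by
  intro T K
  have : T + (t + t' + 1) = (T + t' + t) + 1 := by omega
  rw [this, run, hc, PMF.bind_map, PMF.bind_bind]
  congr 1
  funext a
  exact hd a T K

theorem Runs.seq {c d : Cmd} {s s' s'' : State} {t t' : ℕ}
    (hc : Runs c s s' t) (hd : Runs d s' s'' t') : Runs (.seq c d) s s'' (t + t' + 1) := by
  obtain ⟨u, hu, hc⟩ := hc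
  obtain ⟨u', hu', hd⟩ := hd
  exact ⟨u + u' + 1, by omega, hc.seq hd⟩

/-- Commands without loops and coin tosses. -/
def Cmd.straight : Cmd → Bool
  | .skip => true
  | .assign _ _ => true
  | .push _ _ => true
  | .store _ _ _ => true
  | .flip _ => false
  | .seq c d => c.straight && d.straight
  | .ite _ c d => c.straight && d.straight
  | .loop _ _ => false

/-- The final state of a straight command. -/
def Cmd.final : Cmd → State → State
  | .skip, s => s
  | .assign x e, s => s.setReg x (e.eval s)
  | .push a e, s => s.setArr (a.eval s) (s.arr (a.eval s) ++ [e.eval s])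
  | .store a i e, s => s.setArr (a.eval s) ((s.arr (a.eval s)).set (i.eval s) (e.eval s))
  | .flip _, s => s
  | .seq c d, s => d.final (c.final s)
  | .ite e c d, s => if e.eval s ≠ 0 then c.final s else d.final s
  | .loop _ _, s => s

/-- The number of steps of a straight command. -/
def Cmd.steps : Cmd → State → ℕ
  | .seq c d, s => c.steps s + d.steps (c.final s) + 1
  | .ite e c d, s => (if e.eval s ≠ 0 then c.steps s else d.steps s) + 1
  | _, _ => 1

/-- A bound on the number of steps of a straight command. -/
def Cmd.size : Cmd → ℕ
  | .seq c d => c.size + d.size + 1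
  | .ite _ c d => c.size + d.size + 1
  | _ => 1

theorem Cmd.steps_le_size (c : Cmd) (s : State) : c.steps s ≤ c.size := by
  induction c generalizing s with
  | seq c d hc hd => simpa [steps, size] using add_le_add (hc s) (hd _)
  | ite e c d hc hd =>
    have := hc s
    have := hd s
    simp only [steps, size]
    split_ifs <;> omega
  | _ => simp [steps, size]

/-- Symbolic execution: for a loop body without loops and coins, an invariant is checked by
simplifying `Cmd.final`. -/
theorem runsIn_of_straight {c : Cmd} (hc : c.straight = true) (s : State) :
    RunsIn c s (c.steps s) (PMF.pure (c.final s)) := by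
  induction c generalizing s with
  | seq c d ihc ihd =>
    simp only [Cmd.straight, Bool.and_eq_true] at hc
    exact (ihc hc.1 s).seq (ihd hc.2 _)
  | ite e c d ihc ihd =>
    simp only [Cmd.straight, Bool.and_eq_true] at hc
    intro T K
    simp only [Cmd.steps, Cmd.final]
    rw [← add_assoc, run]
    split_ifs with h
    · exact ihc hc.1 s T K
    · exact ihd hc.2 s T K
  | flip => simp [Cmd.straight] at hc
  | loop => simp [Cmd.straight] at hc
  | _ =>
    intro T K
    simp [Cmd.steps, Cmd.final, run]

theorem runs_of_straight {c : Cmd} (hc : c.straight = true) (s : State) :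
    Runs c s (c.final s) c.size :=
  ⟨_, c.steps_le_size s, runsIn_of_straight hc s⟩

theorem runsIn_loop_false {e : Expr} {c : Cmd} {s : State} (h : e.eval s = 0) :
    RunsIn (.loop e c) s 1 (PMF.pure s) := by
  intro T K
  simp [run, h]

theorem runsIn_loop_true {e : Expr} {c : Cmd} {s : State} {α : Type} {ν : PMF α} {σ : α → State}
    {t t' : ℕ} {μ : α → PMF State} (h : e.eval s ≠ 0) (hc : RunsIn c s t (ν.map σ))
    (hd : ∀ a, RunsIn (.loop e c) (σ a) t' (μ a)) :
    RunsIn (.loop e c) s (t + t' + 1) (ν.bind μ) := by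
  intro T K
  have : T + (t + t' + 1) = (T + t' + t) + 1 := by omega
  rw [this, run, if_pos h, hc, PMF.bind_map, PMF.bind_bind]
  congr 1
  funext a
  exact hd a T K

/-- The rule for loops with a known number of iterations. -/
theorem runs_loop {e : Expr} {c : Cmd} {t : ℕ} (I : ℕ → State → Prop) (m : ℕ)
    (hstep : ∀ k s, k < m → I k s → e.eval s ≠ 0 ∧ ∃ s', Runs c s s' t ∧ I (k + 1) s')
    (hend : ∀ s, I m s → e.eval s = 0) {s : State} (h0 : I 0 s) :
    ∃ s', Runs (.loop e c) s s' (m * (t + 1) + 1) ∧ I m s' := by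
  -- Induction on the number `j` of iterations still to come, while the invariant counts those
  -- already done.
  suffices H : ∀ j k s, k + j = m → I k s →
      ∃ s', Runs (.loop e c) s s' (j * (t + 1) + 1) ∧ I m s' from H m 0 s (by omega) h0
  intro j
  induction j with
  | zero =>
    intro k s hk h
    obtain rfl : k = m := by omega
    exact ⟨s, ⟨1, by omega, runsIn_loop_false (hend s h)⟩, h⟩
  | succ j ih =>
    intro k s hk h
    obtain ⟨he, s₁, ⟨u, hu, hc⟩, h₁⟩ := hstep k s (by omega) h
    obtain ⟨s₂, ⟨u', hu', hd⟩, h₂⟩ := ih (k + 1) s₁ (by omega) h₁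
    refine ⟨s₂, ⟨u + u' + 1, by rw [Nat.succ_mul]; omega, ?_⟩, h₂⟩
    have := runsIn_loop_true (ν := PMF.pure ()) (σ := fun _ => s₁) (μ := fun _ => PMF.pure s₂) he
      (by simpa [PMF.pure_map] using hc) (fun _ => hd)
    simpa using this

/-- Sequences of commands. -/
def block : List Cmd → Cmd
  | [] => .skip
  | c :: l => .seq c (block l)

theorem exec_eq_pure {c : Cmd} {inp : List (List ℕ)} {s' : State} {t T : ℕ}
    (h : Runs c (State.start inp) s' t) (hT : t ≤ T) :
    c.exec T inp = PMF.pure (some s'.arr) := by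
  obtain ⟨u, hu, h⟩ := h
  obtain ⟨r, rfl⟩ := Nat.exists_eq_add_of_le' (hu.trans hT)
  rw [Cmd.exec, h, PMF.pure_bind]
  cases r <;> simp [run, PMF.pure_map]

theorem exec_eq_map {c : Cmd} {inp : List (List ℕ)} {α : Type} {μ : PMF α} {σ : α → State}
    {t T : ℕ} (h : RunsIn c (State.start inp) t (μ.map σ)) (hT : t ≤ T) :
    c.exec T inp = μ.map fun a => some (σ a).arr := by
  obtain ⟨r, rfl⟩ := Nat.exists_eq_add_of_le' hT
  rw [Cmd.exec, h]
  cases r <;> simp [run, PMF.bind_map, PMF.map_bind, PMF.pure_map, Function.comp_def] <;> rfl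

section Matching

/-! ## Matching by auction -/

/-- Hall's condition for the items in `Q`: edge `i < M` joins the item `X i` and the
bucket `V i`. -/
def HallCondition (M : ℕ) (X V : ℕ → ℕ) (Q : List ℕ) : Prop :=
  ∀ S : Finset ℕ, S ⊆ Q.toFinset →
    S.card ≤ (((Finset.range M).filter fun i => X i ∈ S).image V).card

/-- The item to which a bucket with history `h` is assigned. -/
def owner (X : ℕ → ℕ) (h : List ℕ) : Option ℕ := h.getLast?.map X

theorem owner_concat (X : ℕ → ℕ) (h : List ℕ) (e : ℕ) : owner X (h ++ [e]) = some (X e) := by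
  simp [owner]

theorem exists_owner {X : ℕ → ℕ} {h : List ℕ} (hh : h ≠ []) : ∃ x, owner X h = some x := by
  simp [owner, List.getLast?_eq_some_getLast hh]

/-- The invariant of the auction. The history `H v` lists the edges by which items have been
assigned to `v`, its length is the price of `v`. The first `k` items of `Q` have been
considered, all of them except possibly `cur` are assigned. -/
structure AuctionInv (M : ℕ) (X V : ℕ → ℕ) (Q : List ℕ) (H : ℕ → List ℕ) (k : ℕ)
    (cur : Option ℕ) : Prop where
  edge : ∀ v, ∀ e ∈ H v, e < M ∧ V e = v
  le : k ≤ Q.length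
  cur_mem : ∀ x, cur = some x → x ∈ Q.take k
  assigned : ∀ x ∈ Q.take k, cur = some x ∨ ∃ v, owner X (H v) = some x
  owner_mem : ∀ v x, owner X (H v) = some x → x ∈ Q.take k ∧ cur ≠ some x
  inj : ∀ v w x, owner X (H v) = some x → owner X (H w) = some x → v = w
  -- Approximate complementary slackness. An item chooses a cheapest neighbour and raises its price
  -- by one; while it owns this bucket its own price is fixed and the other prices can only grow.
  price : ∀ v x, owner X (H v) = some x → ∀ i < M, X i = x →
    (H v).length ≤ (H (V i)).length + 1

variable {M : ℕ} {X V : ℕ → ℕ} {Q : List ℕ} {H : ℕ → List ℕ} {k : ℕ} {cur : Option ℕ}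

theorem auctionInv_start : AuctionInv M X V Q (fun _ => []) 0 none := by
  constructor <;> simp [owner]

theorem AuctionInv.load (h : AuctionInv M X V Q H k none) (hQ : Q.Nodup) (hk : k < Q.length) :
    AuctionInv M X V Q H (k + 1) (some (Q.getD k 0)) := by
  have htake : Q.take (k + 1) = Q.take k ++ [Q.getD k 0] := by
    rw [List.take_add_one, List.getElem?_eq_getElem hk]
    simp [List.getD_eq_getElem?_getD, hk]
  have hnot : Q.getD k 0 ∉ Q.take k := by
    have := hQ.sublist (List.take_sublist (k + 1) Q)
    rw [htake, List.nodup_append] at this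
    intro hm
    exact this.2.2 _ hm _ (by simp) rfl
  refine ⟨h.edge, hk, ?_, ?_, ?_, h.inj, h.price⟩
  · rintro x hx
    rw [htake]
    simp at hx
    simp [hx]
  · intro x hx
    rw [htake, List.mem_append] at hx
    rcases hx with hx | hx
    · rcases h.assigned x hx with h' | h'
      · cases h'
      · exact Or.inr h'
    · left
      simp at hx
      simp [hx]
  · intro v x hv
    have := (h.owner_mem v x hv).1
    refine ⟨by rw [htake]; exact List.mem_append_left _ this, ?_⟩
    rintro h'
    rw [Option.some_inj] at h'
    exact hnot (h' ▸ this)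

/-- The evicted owner, if any, becomes the current item. For `x` the price condition is `hmin`; for
the others it survives because no price drops. -/
theorem AuctionInv.place {x e : ℕ} (h : AuctionInv M X V Q H k (some x)) (he : e < M)
    (hx : X e = x)
    (hmin : ∀ i < M, X i = x → (H (V e)).length ≤ (H (V i)).length) :
    AuctionInv M X V Q (Function.update H (V e) (H (V e) ++ [e])) k (owner X (H (V e))) := by
  have hlen : ∀ v, (H v).length ≤ (Function.update H (V e) (H (V e) ++ [e]) v).length := by
    intro v
    by_cases hv : v = V e
    · subst hv; simp
    · simp [hv]
  have hown : ∀ v, owner X (Function.update H (V e) (H (V e) ++ [e]) v) =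
      if v = V e then some x else owner X (H v) := by
    intro v
    by_cases hv : v = V e
    · subst hv; simp [owner_concat, hx]
    · simp [hv]
  constructor
  · intro v e' he'
    by_cases hv : v = V e
    · subst hv
      simp only [Function.update_self, List.mem_append, List.mem_singleton] at he'
      rcases he' with h' | rfl
      · exact h.edge _ _ h'
      · exact ⟨he, rfl⟩
    · rw [Function.update_of_ne hv] at he'
      exact h.edge _ _ he'
  · exact h.le
  · intro y hy
    exact (h.owner_mem _ _ hy).1
  · intro y hy
    rcases h.assigned y hy with h' | ⟨v, hv⟩
    · right
      exact ⟨V e, by rw [hown, if_pos rfl, h']⟩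
    · by_cases hve : v = V e
      · left; rw [← hve, hv]
      · right; exact ⟨v, by rw [hown, if_neg hve, hv]⟩
  · intro v y hv
    rw [hown] at hv
    split_ifs at hv with hve
    · cases hv
      exact ⟨h.cur_mem _ rfl, fun h' => (h.owner_mem _ _ h').2 rfl⟩
    · exact ⟨(h.owner_mem _ _ hv).1, fun h' => hve (h.inj _ _ _ hv h')⟩
  · intro v w y hv hw
    rw [hown] at hv hw
    split_ifs at hv hw with h1 h2 h2
    · rw [h1, h2]
    · cases hv
      exact absurd rfl (h.owner_mem _ _ hw).2
    · cases hw
      exact absurd rfl (h.owner_mem _ _ hv).2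
    · exact h.inj _ _ _ hv hw
  · intro v y hv i hi hiy
    rw [hown] at hv
    refine le_trans ?_ (Nat.add_le_add_right (hlen (V i)) 1)
    split_ifs at hv with hve
    · cases hv
      subst hve
      simpa using hmin i hi hiy
    · rw [Function.update_of_ne hve]
      exact h.price v y hv i hi hiy

/-- Under Hall's condition, an unassigned item has a neighbour of small price. -/
theorem AuctionInv.price_le {x κ : ℕ} (h : AuctionInv M X V Q H k (some x))
    (hall : HallCondition M X V Q) (hmin : ∀ i < M, X i = x → κ ≤ (H (V i)).length) :
    κ ≤ Q.length := by
  classical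
  -- Otherwise every neighbour of `x` costs more than `Q.length`. All price levels from 1 to
  -- `Q.length` are then occupied, by too many different owners.
  by_contra! hκ
  have hxQ : x ∈ Q.toFinset := by
    simpa using List.mem_of_mem_take (h.cur_mem x rfl)
  have hne : ∀ v j, j < (H v).length → ∃ y, owner X (H v) = some y := fun v j hj =>
    exists_owner (by intro h'; simp [h'] at hj)
  have hV : ∀ v j, j < (H v).length → v ∈ (Finset.range M).image V := by
    intro v j hj
    obtain ⟨e, he⟩ := List.exists_mem_of_length_pos (by omega : 0 < (H v).length)
    have := h.edge v e he
    exact Finset.mem_image.2 ⟨e, by simpa using this.1, this.2⟩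
  -- If no bucket had price `j`, let `O` be the buckets of price above `j`. Their owners together
  -- with `x` are `O.card + 1` items whose neighbours all lie in `O`, against Hall's condition.
  have gap : ∀ j, 1 ≤ j → j ≤ Q.length → ∃ v, (H v).length = j := by
    intro j hj1 hj
    by_contra! hgap
    set O := ((Finset.range M).image V).filter fun v => j < (H v).length with hO
    have hmemO : ∀ v, v ∈ O ↔ j < (H v).length := fun v => by
      rw [hO, Finset.mem_filter]
      exact ⟨fun h' => h'.2, fun h' => ⟨hV v j h', h'⟩⟩
    set g : ℕ → ℕ := fun v => (owner X (H v)).getD 0 with hg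
    have hgO : ∀ v ∈ O, owner X (H v) = some (g v) := by
      intro v hv
      obtain ⟨y, hy⟩ := hne v j ((hmemO v).1 hv)
      simp [hg, hy]
    have hcard : (insert x (O.image g)).card = O.card + 1 := by
      rw [Finset.card_insert_of_notMem, Finset.card_image_of_injOn]
      · intro v hv w hw hvw
        exact h.inj v w (g v) (hgO v hv) (by rw [hgO w hw]; exact congrArg some hvw.symm)
      · intro hx
        obtain ⟨v, hv, hvx⟩ := Finset.mem_image.1 hx
        exact (h.owner_mem v x (by rw [hgO v hv, hvx])).2 rfl
    have hsub : insert x (O.image g) ⊆ Q.toFinset := by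
      intro y hy
      rcases Finset.mem_insert.1 hy with rfl | hy
      · exact hxQ
      · obtain ⟨v, hv, rfl⟩ := Finset.mem_image.1 hy
        simpa using List.mem_of_mem_take (h.owner_mem v _ (hgO v hv)).1
    -- A neighbour of an owner in `O` has price at least `j` by the price invariant, and not exactly
    -- `j` by the gap. A neighbour of `x` costs at least `κ`, which exceeds `j`.
    have hN : ((Finset.range M).filter fun i => X i ∈ insert x (O.image g)).image V ⊆ O := by
      intro w hw
      obtain ⟨i, hi, rfl⟩ := Finset.mem_image.1 hw
      rw [Finset.mem_filter, Finset.mem_range] at hi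
      rw [hmemO]
      rcases Finset.mem_insert.1 hi.2 with hix | hiO
      · have := hmin i hi.1 hix
        omega
      · obtain ⟨v, hv, hvi⟩ := Finset.mem_image.1 hiO
        have h1 := h.price v _ (hgO v hv) i hi.1 hvi.symm
        have h2 := (hmemO v).1 hv
        have h3 := hgap (V i)
        omega
    have := (hall _ hsub).trans (Finset.card_le_card hN)
    omega
  choose! v hv using gap
  -- One bucket at each level gives `Q.length` distinct owners in the query, none of them `x`.
  have key : Q.length ≤ ((Q.toFinset).erase x).card := by
    have : ((Finset.Icc 1 Q.length).image fun j => (owner X (H (v j))).getD 0) ⊆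
        Q.toFinset.erase x := by
      intro y hy
      obtain ⟨j, hj, rfl⟩ := Finset.mem_image.1 hy
      rw [Finset.mem_Icc] at hj
      obtain ⟨y, hy⟩ := hne (v j) 0 (by rw [hv j hj.1 hj.2]; omega)
      have := h.owner_mem _ _ hy
      simp only [hy, Option.getD_some, Finset.mem_erase, List.mem_toFinset]
      exact ⟨fun h' => this.2 (by rw [h']), List.mem_of_mem_take this.1⟩
    have h2 := Finset.card_le_card this
    rw [Finset.card_image_of_injOn] at h2
    · simpa using h2
    · intro i hi j hj hij
      rw [Finset.coe_Icc, Set.mem_Icc] at hi hj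
      obtain ⟨y, hy⟩ := hne (v i) 0 (by rw [hv i hi.1 hi.2]; omega)
      obtain ⟨z, hz⟩ := hne (v j) 0 (by rw [hv j hj.1 hj.2]; omega)
      simp only [hy, hz, Option.getD_some] at hij
      subst hij
      rw [← hv i hi.1 hi.2, ← hv j hj.1 hj.2, h.inj _ _ _ hy hz]
  rw [Finset.card_erase_of_mem hxQ] at key
  have h1 := Q.toFinset_card_le
  have h2 : 0 < Q.toFinset.card := Finset.card_pos.2 ⟨x, hxQ⟩
  omega

/-- The state of the auction after `r` rounds. -/
structure AuctionState (M b : ℕ) (X V : ℕ → ℕ) (Q : List ℕ) (r : ℕ) (H : ℕ → List ℕ) (k : ℕ)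
    (cur : Option ℕ) : Prop extends AuctionInv M X V Q H k cur where
  -- The only field that assumes Hall's condition. The chosen bucket costs at most `Q.length` before
  -- the raise, hence the 1.
  price_bound : HallCondition M X V Q → ∀ v, (H v).length ≤ Q.length + 1
  -- The potential: total price plus number of loaded items grows by one in every round that is not
  -- idle.
  progress : (cur = none ∧ k = Q.length) ∨ r ≤ (∑ v ∈ Finset.range b, (H v).length) + k

theorem auctionState_start (b : ℕ) : AuctionState M b X V Q 0 (fun _ => []) 0 none :=
  { auctionInv_start with
    price_bound := by simp
    progress := by simp }

variable {b r : ℕ}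

theorem AuctionState.idle (h : AuctionState M b X V Q r H k none) (hk : ¬ k < Q.length) :
    AuctionState M b X V Q (r + 1) H k none :=
  { h with progress := Or.inl ⟨rfl, by have := h.le; omega⟩ }

theorem AuctionState.load (h : AuctionState M b X V Q r H k none) (hQ : Q.Nodup)
    (hk : k < Q.length) :
    AuctionState M b X V Q (r + 1) H (k + 1) (some (Q.getD k 0)) :=
  { h.toAuctionInv.load hQ hk with
    price_bound := h.price_bound
    progress := by
      have := h.progress
      simp only [reduceCtorEq, false_and, false_or]
      simp only [true_and] at this
      omega }

theorem AuctionState.place {x e : ℕ} (h : AuctionState M b X V Q r H k (some x)) (he : e < M)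
    (hx : X e = x) (hb : V e < b)
    (hmin : ∀ i < M, X i = x → (H (V e)).length ≤ (H (V i)).length) :
    AuctionState M b X V Q (r + 1) (Function.update H (V e) (H (V e) ++ [e])) k
      (owner X (H (V e))) :=
  { h.toAuctionInv.place he hx hmin with
    price_bound := by
      intro hall v
      have := h.price_bound hall v
      by_cases hv : v = V e
      · subst hv
        have := h.toAuctionInv.price_le hall hmin
        simpa using this
      · simpa [hv] using this
    progress := by
      right
      have hp := h.progress
      simp only [reduceCtorEq, false_and, false_or] at hp
      have hmem : V e ∈ Finset.range b := by simpa using hb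
      rw [← Finset.add_sum_erase _ _ hmem] at hp ⊢
      have : ∑ v ∈ (Finset.range b).erase (V e),
          (Function.update H (V e) (H (V e) ++ [e]) v).length =
          ∑ v ∈ (Finset.range b).erase (V e), (H v).length :=
        Finset.sum_congr rfl fun v hv => by
          rw [Function.update_of_ne (Finset.ne_of_mem_erase hv)]
      rw [this]
      simp
      omega }

/-- After sufficiently many rounds every item is assigned. -/
theorem AuctionState.exists_owner (h : AuctionState M b X V Q r H k cur)
    (hall : HallCondition M X V Q) (hr : b * (Q.length + 1) + Q.length < r) {x : ℕ}
    (hx : x ∈ Q) : ∃ v, owner X (H v) = some x := by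
  -- This and `k ≤ Q.length` bound the potential by a number below `r`, so the auction must have
  -- become idle.
  have hsum : ∑ v ∈ Finset.range b, (H v).length ≤ b * (Q.length + 1) := by
    simpa using Finset.sum_le_card_nsmul (Finset.range b) _ _ fun v _ => h.price_bound hall v
  have hle := h.le
  rcases h.progress with ⟨hc, hk⟩ | hp
  · subst hc hk
    rcases h.assigned x (by simpa using hx) with h' | h'
    · cases h'
    · exact h'
  · omega

end Matching

/-! ## The parameters as a table of edges -/

/-- The number of edges before edge `i` that lead to the same bucket. -/
def rank (l : List ℕ) (i : ℕ) : ℕ := (l.take i).count (l.getD i 0)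

/-- The parameters: for every edge `i` its item `i % n`, its bucket `l i`, and the position of
its codeword in this bucket. -/
def table (n : ℕ) (l : List ℕ) : List ℕ :=
  (List.range l.length).flatMap fun i => [i % n, l.getD i 0, rank l i]

/-- The rank of an edge depends on earlier edges only, so finished rows never change and `Init` can
write the table while it samples. -/
theorem table_concat (n : ℕ) (l : List ℕ) (v : ℕ) :
    table n (l ++ [v]) = table n l ++ [l.length % n, v, l.count v] := by
  have h : ∀ i ∈ List.range l.length,
      [i % n, (l ++ [v]).getD i 0, rank (l ++ [v]) i] = [i % n, l.getD i 0, rank l i] := by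
    intro i hi
    rw [List.mem_range] at hi
    simp [rank, List.getD_eq_getElem?_getD, List.getElem?_append_left hi,
      List.take_append_of_le_length hi.le]
  rw [table, List.length_append, List.length_singleton, List.range_succ, List.flatMap_append,
    List.flatMap_congr h]
  simp [table, rank]

theorem length_flatMap_triple (f g h : ℕ → ℕ) (m : ℕ) :
    ((List.range m).flatMap fun i => [f i, g i, h i]).length = 3 * m := by
  induction m with
  | zero => simp
  | succ m ih => simp [List.range_succ, List.flatMap_append, mul_add]; omega

theorem getD_flatMap_triple (f g h : ℕ → ℕ) {m i : ℕ} (hi : i < m) :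
    ((List.range m).flatMap fun i => [f i, g i, h i]).getD (3 * i) 0 = f i ∧
    ((List.range m).flatMap fun i => [f i, g i, h i]).getD (3 * i + 1) 0 = g i ∧
    ((List.range m).flatMap fun i => [f i, g i, h i]).getD (3 * i + 2) 0 = h i := by
  induction m with
  | zero => omega
  | succ m ih =>
    rw [List.range_succ, List.flatMap_append]
    have hl := length_flatMap_triple f g h m
    rcases Nat.lt_succ_iff_lt_or_eq.1 hi with h' | rfl
    · obtain ⟨h1, h2, h3⟩ := ih h'
      rw [List.getD_append _ _ _ _ (by omega), List.getD_append _ _ _ _ (by omega),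
        List.getD_append _ _ _ _ (by omega)]
      exact ⟨h1, h2, h3⟩
    · rw [List.getD_append_right _ _ _ _ (by omega), List.getD_append_right _ _ _ _ (by omega),
        List.getD_append_right _ _ _ _ (by omega), hl]
      simp

theorem length_table (n : ℕ) (l : List ℕ) : (table n l).length = 3 * l.length :=
  length_flatMap_triple ..

theorem table_item {n : ℕ} {l : List ℕ} {i : ℕ} (hi : i < l.length) :
    (table n l).getD (3 * i) 0 = i % n := (getD_flatMap_triple _ _ _ hi).1

theorem table_bucket {n : ℕ} {l : List ℕ} {i : ℕ} (hi : i < l.length) :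
    (table n l).getD (3 * i + 1) 0 = l.getD i 0 := (getD_flatMap_triple _ _ _ hi).2.1

theorem table_rank {n : ℕ} {l : List ℕ} {i : ℕ} (hi : i < l.length) :
    (table n l).getD (3 * i + 2) 0 = rank l i := (getD_flatMap_triple _ _ _ hi).2.2

/-- The content of bucket `v` after the first `k` edges. -/
def bucket (n : ℕ) (l DB : List ℕ) (k v : ℕ) : List ℕ :=
  ((List.range k).filter fun i => l.getD i 0 = v).map fun i => DB.getD (i % n) 0

theorem bucket_succ (n : ℕ) (l DB : List ℕ) (k v : ℕ) :
    bucket n l DB (k + 1) v =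
      bucket n l DB k v ++ if l.getD k 0 = v then [DB.getD (k % n) 0] else [] := by
  rw [bucket, bucket, List.range_succ, List.filter_append, List.map_append]
  split_ifs with h <;> simp_all

theorem length_bucket (n : ℕ) (l DB : List ℕ) {k : ℕ} (hk : k ≤ l.length) (v : ℕ) :
    (bucket n l DB k v).length = (l.take k).count v := by
  induction k with
  | zero => simp [bucket]
  | succ k ih =>
    rw [bucket_succ, List.length_append, ih (by omega), List.take_add_one,
      List.getElem?_eq_getElem (by omega), List.count_append, List.getD_eq_getElem _ _ (by omega)]
    split_ifs with h <;> simp [h]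

theorem bucket_prefix (n : ℕ) (l DB : List ℕ) {k m : ℕ} (hk : k ≤ m) (v : ℕ) :
    bucket n l DB k v <+: bucket n l DB m v := by
  induction m, hk using Nat.le_induction with
  | base => exact List.prefix_rfl
  | succ m _ ih =>
    rw [bucket_succ]
    exact ih.trans (List.prefix_append _ _)

theorem rank_lt (n : ℕ) {l : List ℕ} (DB : List ℕ) {i : ℕ} (hi : i < l.length) :
    rank l i < (bucket n l DB l.length (l.getD i 0)).length := by
  have h := (bucket_prefix n l DB (k := i + 1) hi (l.getD i 0)).length_le
  rw [bucket_succ, if_pos rfl, List.length_append, length_bucket n l DB hi.le] at h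
  simpa [rank] using h

/-- When edge `i` is reached, its bucket holds exactly `rank l i` words. Its word lands at that
position and stays there, because later words are appended behind it. -/
theorem bucket_getD_rank (n : ℕ) {l : List ℕ} (DB : List ℕ) {i : ℕ} (hi : i < l.length) :
    (bucket n l DB l.length (l.getD i 0)).getD (rank l i) 0 = DB.getD (i % n) 0 := by
  obtain ⟨t, ht⟩ := bucket_prefix n l DB (k := i + 1) hi (l.getD i 0)
  have hr : rank l i = (bucket n l DB i (l.getD i 0)).length := by
    rw [length_bucket n l DB hi.le, rank]
  rw [← ht, bucket_succ, if_pos rfl, hr, List.append_assoc, List.getD_append_right _ _ _ _ le_rfl]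
  simp

theorem sum_length_bucket_le (n : ℕ) (l DB : List ℕ) (k m : ℕ) :
    (((List.range m).map (bucket n l DB k)).map List.length).sum ≤ k := by
  rw [List.map_map]
  change ∑ v ∈ Finset.range m, (bucket n l DB k v).length ≤ k
  induction k with
  | zero => simp [bucket]
  | succ k ih =>
    simp only [bucket_succ, List.length_append, Finset.sum_add_distrib]
    refine add_le_add ih ?_
    have : ∀ v, (if l.getD k 0 = v then [DB.getD (k % n) 0] else []).length =
        if l.getD k 0 = v then 1 else 0 := fun v => by split_ifs <;> rfl
    simp only [this, Finset.sum_ite_eq]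
    split_ifs <;> simp

theorem mem_of_mem_bucket {n : ℕ} (hn : 0 < n) {l DB : List ℕ} (hDB : DB.length = n) {k v x : ℕ}
    (hx : x ∈ bucket n l DB k v) : x ∈ DB := by
  obtain ⟨i, -, rfl⟩ := List.mem_map.1 hx
  have := Nat.mod_lt i hn
  rw [List.getD_eq_getElem _ _ (by omega)]
  exact List.getElem_mem _

theorem Runs.ite_true {e : Expr} {c d : Cmd} {s s' : State} {t : ℕ} (he : e.eval s ≠ 0)
    (h : Runs c s s' t) : Runs (.ite e c d) s s' (t + 1) := by
  obtain ⟨u, hu, h⟩ := h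
  refine ⟨u + 1, by omega, fun T K => ?_⟩
  rw [← add_assoc, run, if_pos he, h]

theorem Runs.ite_false {e : Expr} {c d : Cmd} {s s' : State} {t : ℕ} (he : e.eval s = 0)
    (h : Runs d s s' t) : Runs (.ite e c d) s s' (t + 1) := by
  obtain ⟨u, hu, h⟩ := h
  refine ⟨u + 1, by omega, fun T K => ?_⟩
  rw [← add_assoc, run, if_neg (not_not.2 he), h]

/-- The entry of an input array with a fixed number. -/
def Expr.input (a : ℕ) (i : Expr) : Expr := .inGet (.const a) i

/-! ## Encoding -/

/-- The loop body of `Encode`: push the codeword of the edge in register `0`. -/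
def encodeBody : Cmd := block
  [.push (.input 1 (.add (.reg 0) (.const 1))) (.input 2 (.input 1 (.reg 0))),
   .assign 0 (.add (.reg 0) (.const 3))]

/-- The program of `Encode`. -/
def encodeProg : Cmd := .loop (.sub (.inLen (.const 1)) (.reg 0)) encodeBody

theorem runs_encodeProg (n : ℕ) (l DB ps : List ℕ) :
    ∃ s', Runs encodeProg (State.start [ps, table n l, DB]) s' (l.length * 6 + 1) ∧
      s'.arr = bucket n l DB l.length := by
  refine (runs_loop (t := 5)
    -- A table row has three entries, so the register that scans the table advances by 3 per edge.
    (fun k s => s.inp = [ps, table n l, DB] ∧ s.reg 0 = 3 * k ∧ s.arr = bucket n l DB k)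
    l.length ?_ ?_ ?_).imp fun s' h => ⟨h.1, h.2.2.2⟩
  · rintro k s hk ⟨hi, hr, ha⟩
    refine ⟨?_, _, runs_of_straight rfl s, ?_⟩
    · simp [Expr.eval, hi, hr, length_table]
      omega
    · have h1 : s.inp.getD 1 [] = table n l := by rw [hi]; rfl
      have h2 : s.inp.getD 2 [] = DB := by rw [hi]; rfl
      refine ⟨hi, ?_⟩
      simp [encodeBody, block, Cmd.final, State.setReg, State.setArr, Expr.eval, Expr.input, h1, h2,
        hr, ha, table_item hk, table_bucket hk, -List.getD_eq_getElem?_getD, mul_add]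
      funext v
      rw [bucket_succ]
      by_cases hv : v = l.getD k 0
      · subst hv; simp
      · simp [hv, Ne.symm hv, -List.getD_eq_getElem?_getD]
  · rintro s ⟨hi, hr, ha⟩
    simp [Expr.eval, hi, hr, length_table]
  · refine ⟨rfl, rfl, ?_⟩
    funext v
    simp [State.start, bucket]

/-! ## Scheduling -/

/-- The positions that are read from a bucket with history `h`. -/
def scheduled (l h : List ℕ) : List ℕ := (h.getLast?.map (rank l)).toList

/-- The number of the history array of the bucket with the given number. -/
def Expr.hist (v : Expr) : Expr := .add (.reg 0) v

/-- The last entry of a work array. -/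
def Expr.last (a : Expr) : Expr := .get a (.sub (.len a) (.const 1))

/-- Let register `5` point to the edge in register `4`. -/
def selectEdge : Cmd := .assign 5 (.add (.reg 4) (.const 1))

/-- The loop body of the search for the cheapest edge of the current item. -/
def searchBody : Cmd := block
  -- Equality is tested by two truncated differences. Register `3` holds the item plus one. Register
  -- `5` is 0 as long as no edge is found, and otherwise points to a bucket entry `3 * e + 1`, which
  -- is never 0.
  [.ite (.sub (.reg 3) (.add (.input 1 (.reg 4)) (.const 1))) .skip
    (.ite (.sub (.add (.input 1 (.reg 4)) (.const 1)) (.reg 3)) .skip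
      (.ite (.reg 5)
        (.ite (.sub (.len (.hist (.input 1 (.reg 5))))
            (.len (.hist (.input 1 (.add (.reg 4) (.const 1)))))) selectEdge .skip)
        selectEdge)),
   .assign 4 (.add (.reg 4) (.const 3))]

/-- The search for the cheapest edge of the current item. -/
def searchLoop : Cmd := .loop (.sub (.inLen (.const 1)) (.reg 4)) searchBody

/-- History lengths are prices, so the edge found satisfies the minimality hypothesis of
`AuctionState.place`. The hypothesis `hx` excludes that the search ends without an edge. -/
theorem runs_searchLoop {n : ℕ} {l : List ℕ} {inp : List (List ℕ)}
    (hinp : inp.getD 1 [] = table n l) (A : ℕ → List ℕ) (B f k x : ℕ) {s : State}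
    (hi : s.inp = inp) (hA : s.arr = A) (h0 : s.reg 0 = B) (h1 : s.reg 1 = f)
    (h2 : s.reg 2 = k) (h3 : s.reg 3 = x + 1) (h4 : s.reg 4 = 0) (h5 : s.reg 5 = 0)
    (hx : ∃ i < l.length, i % n = x) :
    ∃ s', Runs searchLoop s s' (l.length * 14 + 1) ∧ (s'.inp = inp ∧ s'.arr = A ∧ s'.reg 0 = B ∧
      s'.reg 1 = f ∧ s'.reg 2 = k ∧ s'.reg 3 = x + 1) ∧ ∃ e < l.length, s'.reg 5 = 3 * e + 1 ∧
      e % n = x ∧ ∀ i < l.length, i % n = x →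
        (A (B + l.getD e 0)).length ≤ (A (B + l.getD i 0)).length := by
  refine (runs_loop (t := 13) (fun m s => (s.inp = inp ∧ s.arr = A ∧ s.reg 0 = B ∧ s.reg 1 = f ∧
      s.reg 2 = k ∧ s.reg 3 = x + 1) ∧ s.reg 4 = 3 * m ∧
      ((s.reg 5 = 0 ∧ ∀ i < m, i % n ≠ x) ∨ ∃ e < m, s.reg 5 = 3 * e + 1 ∧ e % n = x ∧
        ∀ i < m, i % n = x → (A (B + l.getD e 0)).length ≤ (A (B + l.getD i 0)).length))
    l.length ?_ ?_ ?_).imp fun s' h => ⟨h.1, h.2.1, ?_⟩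
  · rintro m s hm ⟨⟨hi, hA, h0, h1, h2, h3⟩, h4, h5⟩
    refine ⟨?_, _, runs_of_straight rfl s, ?_⟩
    · simp [Expr.eval, hi, h4, length_table, hinp, -List.getD_eq_getElem?_getD]
      omega
    · by_cases hmx : m % n = x
      · rcases h5 with ⟨h5, hno⟩ | ⟨e, he, h5, hex, hmin⟩
        · simp [searchBody, selectEdge, block, Cmd.final, State.setReg, State.setArr, Expr.eval,
            Expr.input, Expr.hist, hi, hinp, hA, h0, h1, h2, h3, h4, h5, table_item hm,
            table_bucket hm, hmx, -List.getD_eq_getElem?_getD, mul_add]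
          intro i hi hix
          rcases hi.lt_or_eq with h' | rfl
          · exact absurd hix (hno i h')
          · exact le_rfl
        · by_cases hlt : (A (B + l.getD m 0)).length < (A (B + l.getD e 0)).length
          · simp [searchBody, selectEdge, block, Cmd.final, State.setReg, State.setArr, Expr.eval,
              Expr.input, Expr.hist, hi, hinp, hA, h0, h1, h2, h3, h4, h5, table_item hm,
              table_bucket hm, table_bucket (he.trans hm), hmx, Nat.sub_eq_zero_iff_le, hlt,
              not_le.2 hlt, -List.getD_eq_getElem?_getD, mul_add]
            intro i hi hix
            rcases hi.lt_or_eq with h' | rfl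
            · exact hlt.le.trans (hmin i h' hix)
            · exact le_rfl
          · simp [searchBody, selectEdge, block, Cmd.final, State.setReg, State.setArr, Expr.eval,
              Expr.input, Expr.hist, hi, hinp, hA, h0, h1, h2, h3, h4, h5, table_item hm,
              table_bucket hm, table_bucket (he.trans hm), hmx, Nat.sub_eq_zero_iff_le, hlt,
              not_lt.1 hlt, -List.getD_eq_getElem?_getD, mul_add]
            refine ⟨he.le, hex, fun i hi hix => ?_⟩
            rcases hi.lt_or_eq with h' | rfl
            · exact hmin i h' hix
            · exact not_lt.1 hlt
      · have hfin : searchBody.final s = s.setReg 4 (3 * (m + 1)) := by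
          rcases Nat.lt_or_gt_of_ne hmx with hlt | hlt
          · have h' : ¬ x ≤ m % n := not_le.2 hlt
            simp [searchBody, selectEdge, block, Cmd.final, State.setReg, State.setArr, Expr.eval,
              Expr.input, Expr.hist, hi, hinp, hA, h0, h1, h2, h3, h4, table_item hm,
              Nat.sub_eq_zero_iff_le, h', -List.getD_eq_getElem?_getD, mul_add]
          · have h' : ¬ m % n ≤ x := not_le.2 hlt
            simp [searchBody, selectEdge, block, Cmd.final, State.setReg, State.setArr, Expr.eval,
              Expr.input, Expr.hist, hi, hinp, hA, h0, h1, h2, h3, h4, table_item hm,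
              Nat.sub_eq_zero_iff_le, h', hlt.le, -List.getD_eq_getElem?_getD, mul_add]
        rw [hfin]
        refine ⟨⟨hi, hA, ?_⟩, ?_⟩
        · simp [State.setReg, h0, h1, h2, h3]
        · simp only [State.setReg, Function.update_self, true_and, ne_eq, OfNat.ofNat_eq_ofNat,
            Nat.reduceEqDiff, not_false_eq_true, Function.update_of_ne]
          refine h5.imp (fun h' => ⟨h'.1, fun i hi hix => ?_⟩) ?_
          · rcases Nat.lt_succ_iff_lt_or_eq.1 hi with h'' | rfl
            · exact h'.2 i h'' hix
            · exact hmx hix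
          · rintro ⟨e, he, h5, hex, hmin⟩
            refine ⟨e, by omega, h5, hex, fun i hi hix => ?_⟩
            rcases Nat.lt_succ_iff_lt_or_eq.1 hi with h'' | rfl
            · exact hmin i h'' hix
            · exact absurd hix hmx
  · rintro s ⟨⟨hi, -⟩, h4, -⟩
    simp [Expr.eval, hi, h4, length_table, hinp, -List.getD_eq_getElem?_getD]
  · exact ⟨⟨hi, hA, h0, h1, h2, h3⟩, h4, Or.inl ⟨h5, by simp⟩⟩
  · rcases h.2.2.2 with h' | h'
    · obtain ⟨i, hi, hix⟩ := hx
      exact absurd hix (h'.2 i hi)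
    · exact h'

/-- The state of the machine represents the state of an auction with `B` bucket numbers. -/
structure Represents (s : State) (inp : List (List ℕ)) (B f : ℕ) (H : ℕ → List ℕ) (k : ℕ)
    (cur : Option ℕ) : Prop where
  inp_eq : s.inp = inp
  base : s.reg 0 = B
  fuel : s.reg 1 = f
  next : s.reg 2 = k
  -- Shifted by one, so that 0 means that no item is current.
  cur_eq : s.reg 3 = cur.elim 0 (· + 1)
  -- Histories start at array `B`, which keeps the arrays below `B` free for the output. They store
  -- row offsets `3 * e` instead of edge numbers, since the machine cannot multiply.
  hist : ∀ v, s.arr (B + v) = (H v).map (3 * ·)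
  out : ∀ v < B, s.arr v = []

/-- Assign the current item by the edge to which register `5` points. -/
def placeCmd : Cmd := block
  [.assign 6 (.hist (.input 1 (.reg 5))),
   -- The evicted owner is the item of the last recorded edge; it has to be read before the new edge
   -- is pushed.
   .ite (.len (.reg 6)) (.assign 3 (.add (.input 1 (.last (.reg 6))) (.const 1)))
     (.assign 3 (.const 0)),
   .push (.reg 6) (.sub (.reg 5) (.const 1))]

theorem represents_placeCmd {n : ℕ} {l : List ℕ} {inp : List (List ℕ)}
    (hinp : inp.getD 1 [] = table n l) {s : State} {B f k x e : ℕ} {H : ℕ → List ℕ}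
    (h : Represents s inp B f H k (some x)) (h5 : s.reg 5 = 3 * e + 1) (he : e < l.length)
    (hH : ∀ v, ∀ i ∈ H v, i < l.length) :
    Represents (placeCmd.final s) inp B f
      (Function.update H (l.getD e 0) (H (l.getD e 0) ++ [e])) k
      (owner (· % n) (H (l.getD e 0))) := by
  have hfin : placeCmd.final s = ((s.setReg 6 (B + l.getD e 0)).setReg 3
      ((owner (· % n) (H (l.getD e 0))).elim 0 (· + 1))).setArr (B + l.getD e 0)
        (s.arr (B + l.getD e 0) ++ [3 * e]) := by
    rcases List.eq_nil_or_concat (H (l.getD e 0)) with h' | ⟨h', i, hi⟩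
    · simp [placeCmd, block, Cmd.final, State.setReg, State.setArr, Expr.eval, Expr.input,
        Expr.hist, Expr.last, h.inp_eq, h5, h.base, hinp, table_bucket he, h.hist, h', owner,
        -List.getD_eq_getElem?_getD]
    · have hil : i < l.length := hH (l.getD e 0) i (by rw [hi]; simp)
      rw [List.concat_eq_append] at hi
      have hlast : (h'.map (3 * ·) ++ [3 * i]).getD h'.length 0 = 3 * i := by
        rw [List.getD_append_right _ _ _ _ (by simp)]
        simp
      simp [placeCmd, block, Cmd.final, State.setReg, State.setArr, Expr.eval, Expr.input,
        Expr.hist, Expr.last, h.inp_eq, h5, h.base, hinp, table_bucket he, h.hist, hi, owner,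
        hlast, table_item hil, -List.getD_eq_getElem?_getD]
  rw [hfin]
  constructor
  · exact h.inp_eq
  · simp [State.setReg, State.setArr, h.base]
  · simp [State.setReg, State.setArr, h.fuel]
  · simp [State.setReg, State.setArr, h.next]
  · simp [State.setReg, State.setArr]
  · intro v
    by_cases hv : v = l.getD e 0
    · subst hv
      simp [State.setReg, State.setArr, h.hist]
    · simp [State.setReg, State.setArr, h.hist, hv, -List.getD_eq_getElem?_getD]
  · intro v hv
    have : v ≠ B + l.getD e 0 := by omega
    simp [State.setReg, State.setArr, this, h.out v hv, -List.getD_eq_getElem?_getD]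

/-- The next item of the query becomes the current item. -/
def loadCmd : Cmd := block
  [.assign 3 (.add (.input 2 (.reg 2)) (.const 1)), .assign 2 (.add (.reg 2) (.const 1))]

/-- One round of the auction. -/
def roundBody : Cmd := .seq (.assign 1 (.sub (.reg 1) (.const 1)))
  (.ite (.reg 3)
    (.seq (.assign 4 (.const 0)) (.seq (.assign 5 (.const 0)) (.seq searchLoop placeCmd)))
    (.ite (.sub (.input 0 (.const 1)) (.reg 2)) loadCmd .skip))

/-- A round places the current item, loads the next one, or idles, according to `cur` and `k`. The
hypothesis `hX` provides every item with an edge to choose. -/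
theorem runs_roundBody {n q lam B b : ℕ} {l Q : List ℕ}
    (hQ : IsQuery n q Q) (hl : ∀ v ∈ l, v < b) (hX : ∀ x < n, ∃ i < l.length, i % n = x)
    {s : State} {r f k : ℕ} {H : ℕ → List ℕ} {cur : Option ℕ}
    (h : Represents s [[n, q, lam], table n l, Q] B (f + 1) H k cur)
    (ha : AuctionState l.length b (· % n) (fun i => l.getD i 0) Q r H k cur) :
    ∃ s' H' k' cur', Runs roundBody s s' (l.length * 14 + 22) ∧
      Represents s' [[n, q, lam], table n l, Q] B f H' k' cur' ∧
      AuctionState l.length b (· % n) (fun i => l.getD i 0) Q (r + 1) H' k' cur' := by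
  obtain ⟨hQl, hQn, hQm⟩ := hQ
  set s₁ := s.setReg 1 f with hs₁
  have hassign : Runs (.assign 1 (.sub (.reg 1) (.const 1))) s s₁ 1 := by
    have := runs_of_straight (c := .assign 1 (.sub (.reg 1) (.const 1))) rfl s
    simpa [Cmd.final, Expr.eval, h.fuel, Cmd.size] using this
  have h₁ : Represents s₁ [[n, q, lam], table n l, Q] B f H k cur := by
    constructor
    · exact h.inp_eq
    · simp [hs₁, State.setReg, h.base]
    · simp [hs₁, State.setReg]
    · simp [hs₁, State.setReg, h.next]
    · simp [hs₁, State.setReg, h.cur_eq]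
    · exact h.hist
    · exact h.out
  clear_value s₁
  cases cur with
  | some x =>
    have hxn : x < n := hQm x (List.mem_of_mem_take (ha.cur_mem x rfl))
    set s₂ := (s₁.setReg 4 0).setReg 5 0 with hs₂
    obtain ⟨s₃, hrun, ⟨hi, hA, h0, h1, h2, h3⟩, e, he, h5, hex, hmin⟩ :=
      runs_searchLoop (n := n) (l := l) (inp := [[n, q, lam], table n l, Q]) rfl s₁.arr B f k x
        (s := s₂) h₁.inp_eq rfl (by simp [hs₂, State.setReg, h₁.base])
        (by simp [hs₂, State.setReg, h₁.fuel]) (by simp [hs₂, State.setReg, h₁.next])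
        (by simp [hs₂, State.setReg, h₁.cur_eq]) (by simp [hs₂, State.setReg])
        (by simp [hs₂, State.setReg]) (hX x hxn)
    have h₃ : Represents s₃ [[n, q, lam], table n l, Q] B f H k (some x) :=
      ⟨hi, h0, h1, h2, h3, by rw [hA]; exact h₁.hist, by rw [hA]; exact h₁.out⟩
    refine ⟨_, _, _, _, ?_, represents_placeCmd rfl h₃ h5 he fun v i hi => (ha.edge v i hi).1,
      ha.place he hex (hl _ ?_) ?_⟩
    · refine (hassign.seq (Runs.ite_true (t := l.length * 14 + 15) ?_ ?_)).mono ?_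
      · simp [Expr.eval, h₁.cur_eq]
      · refine Runs.mono (((runs_of_straight (c := .assign 4 (.const 0)) rfl s₁).seq
          ((runs_of_straight (c := .assign 5 (.const 0)) rfl _).seq
            (hrun.seq (runs_of_straight (c := placeCmd) rfl s₃))))) ?_
        simp [Cmd.size, placeCmd, block]
        omega
      · omega
    · rw [List.getD_eq_getElem _ _ he]
      exact List.getElem_mem _
    · intro i hi hix
      simpa [h₁.hist, -List.getD_eq_getElem?_getD] using hmin i hi hix
  | none =>
    by_cases hk : k < Q.length
    · refine ⟨loadCmd.final s₁, _, _, _, ?_, ?_, ha.load hQn hk⟩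
      · refine (hassign.seq (Runs.ite_false ?_ (Runs.ite_true ?_
          (runs_of_straight (c := loadCmd) rfl s₁)))).mono ?_
        · simp [Expr.eval, h₁.cur_eq]
        · simp [Expr.eval, Expr.input, h₁.inp_eq, h₁.next]
          omega
        · simp [Cmd.size, loadCmd, block]
      · have h2 : s₁.inp.getD 2 [] = Q := by rw [h₁.inp_eq]; rfl
        constructor
        · exact h₁.inp_eq
        all_goals simp [loadCmd, block, Cmd.final, State.setReg, Expr.eval, Expr.input, h2,
          h₁.next, h₁.base, h₁.fuel, h₁.hist, -List.getD_eq_getElem?_getD]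
        exact h₁.out
    · refine ⟨s₁, _, _, _, ?_, h₁, ha.idle hk⟩
      refine (hassign.seq (Runs.ite_false ?_ (Runs.ite_false ?_
          (runs_of_straight (c := .skip) rfl s₁)))).mono ?_
      · simp [Expr.eval, h₁.cur_eq]
      · simp [Expr.eval, Expr.input, h₁.inp_eq, h₁.next]
        omega
      · simp [Cmd.size]

/-- Eight times the query size. -/
def Expr.eightQ : Expr :=
  let q := Expr.input 0 (.const 1)
  let q2 := Expr.add q q
  let q4 := Expr.add q2 q2
  .add q4 q4

/-- Initialization of the auction: the number of rounds goes to register `1`. -/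
def prepareProg : Cmd := .seq
  (block [.assign 0 .eightQ, .assign 6 (.add (.input 0 (.const 1)) (.const 2))])
  (.loop (.reg 6)
    (block [.assign 1 (.add (.reg 1) (.reg 0)), .assign 6 (.sub (.reg 6) (.const 1))]))

/-- The number of rounds is the sum of `q + 2` copies of `8 * q`. It exceeds b(q + 1) + q for every
number b < 8q of buckets. -/
theorem runs_prepareProg (n q lam : ℕ) (prms Q : List ℕ) :
    ∃ s', Runs prepareProg (State.start [[n, q, lam], prms, Q]) s' (q * 6 + 19) ∧
      Represents s' [[n, q, lam], prms, Q] (8 * q) (8 * q * (q + 2)) (fun _ => []) 0 none := by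
  have h1 := runs_of_straight
    (c := block [.assign 0 .eightQ, .assign 6 (.add (.input 0 (.const 1)) (.const 2))]) rfl
    (State.start [[n, q, lam], prms, Q])
  obtain ⟨s', hr, hs'⟩ := runs_loop (e := .reg 6)
    (c := block [.assign 1 (.add (.reg 1) (.reg 0)), .assign 6 (.sub (.reg 6) (.const 1))])
    (t := 5) (fun k s => Represents s [[n, q, lam], prms, Q] (8 * q) (8 * q * k)
      (fun _ => []) 0 none ∧ s.reg 6 = q + 2 - k) (q + 2)
    (by
      rintro k s hk ⟨h, h6⟩
      refine ⟨by simp [Expr.eval, h6]; omega, _, runs_of_straight rfl s, ?_, ?_⟩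
      · constructor
        · exact h.inp_eq
        · simp [block, Cmd.final, State.setReg, Expr.eval, h.base]
        · simp [block, Cmd.final, State.setReg, Expr.eval, h.base, h.fuel, mul_add]
        · simp [block, Cmd.final, State.setReg, Expr.eval, h.next]
        · simp [block, Cmd.final, State.setReg, Expr.eval, h.cur_eq]
        · exact h.hist
        · exact h.out
      · simp [block, Cmd.final, State.setReg, Expr.eval, h6]
        omega)
    (by
      rintro s ⟨h, h6⟩
      simp [Expr.eval, h6])
    (s := (block [.assign 0 .eightQ, .assign 6 (.add (.input 0 (.const 1)) (.const 2))]).final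
      (State.start [[n, q, lam], prms, Q]))
    (by
      constructor
      · constructor
        all_goals simp [block, Cmd.final, State.setReg, Expr.eval, Expr.eightQ, State.start,
          Expr.input]
        omega
      · simp [block, Cmd.final, State.setReg, Expr.eval, Expr.eightQ, State.start, Expr.input])
  refine ⟨s', (h1.seq hr).mono ?_, hs'.1⟩
  simp [block, Cmd.size]
  omega

/-- The loop body that writes the schedule of the bucket in register `4`. -/
def outputBody : Cmd := block
  [.ite (.len (.hist (.reg 4)))
    (.push (.reg 4) (.input 1 (.add (.last (.hist (.reg 4))) (.const 2)))) .skip,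
   .assign 4 (.add (.reg 4) (.const 1))]

/-- Writing the schedule. -/
def outputProg : Cmd := .seq (.assign 4 (.const 0))
  (.loop (.sub (.reg 0) (.reg 4)) outputBody)

theorem runs_outputProg {n : ℕ} {l : List ℕ} {inp : List (List ℕ)}
    (hinp : inp.getD 1 [] = table n l) {s : State} {B f k : ℕ} {H : ℕ → List ℕ}
    {cur : Option ℕ} (h : Represents s inp B f H k cur) (hH : ∀ v, ∀ i ∈ H v, i < l.length) :
    ∃ s', Runs outputProg s s' (B * 8 + 3) ∧ ∀ v < B, s'.arr v = scheduled l (H v) := by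
  have h1 := runs_of_straight (c := .assign 4 (.const 0)) rfl s
  obtain ⟨s', hr, -, -, -, -, hs'⟩ := runs_loop (e := .sub (.reg 0) (.reg 4)) (c := outputBody)
    (t := 7) (fun k s => s.inp = inp ∧ s.reg 0 = B ∧ s.reg 4 = k ∧
      (∀ v, s.arr (B + v) = (H v).map (3 * ·)) ∧
      (∀ v < B, s.arr v = if v < k then scheduled l (H v) else [])) B
    (by
      rintro k s hk ⟨hi, h0, h4, hA, ho⟩
      refine ⟨by simp [Expr.eval, h0, h4]; omega, _, runs_of_straight rfl s, ?_⟩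
      rcases List.eq_nil_or_concat (H k) with h' | ⟨h', i, hi'⟩
      · have hfin : outputBody.final s = s.setReg 4 (k + 1) := by
          simp [outputBody, block, Cmd.final, State.setReg, State.setArr, Expr.eval, Expr.hist,
            h0, h4, hA, h']
        rw [hfin]
        refine ⟨hi, by simp [State.setReg, h0], by simp [State.setReg], hA, fun v hv => ?_⟩
        have := ho v hv
        by_cases hvk : v = k
        · subst hvk
          simp [State.setReg, this, h', scheduled]
        · rw [State.setReg, this]
          have : v < k + 1 ↔ v < k := by omega
          simp only [this]
      · have hil : i < l.length := hH k i (by rw [hi']; simp)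
        rw [List.concat_eq_append] at hi'
        have hlast : (h'.map (3 * ·) ++ [3 * i]).getD h'.length 0 = 3 * i := by
          rw [List.getD_append_right _ _ _ _ (by simp)]
          simp
        have hfin : outputBody.final s = (s.setArr k [rank l i]).setReg 4 (k + 1) := by
          have hok := ho k hk
          simp [outputBody, block, Cmd.final, State.setReg, State.setArr, Expr.eval, Expr.hist,
            Expr.last, Expr.input, h0, h4, hA, hi', hi, hinp, hlast, table_rank hil, hok,
            -List.getD_eq_getElem?_getD]
        rw [hfin]
        refine ⟨hi, by simp [State.setReg, State.setArr, h0], by simp [State.setReg],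
          fun v => ?_, fun v hv => ?_⟩
        · have : B + v ≠ k := by omega
          simp [State.setReg, State.setArr, hA, this]
        · have := ho v hv
          by_cases hvk : v = k
          · subst hvk
            simp [State.setReg, State.setArr, hi', scheduled]
          · have h' : v < k + 1 ↔ v < k := by omega
            simp [State.setReg, State.setArr, hvk, this, h'])
    (by
      rintro s ⟨hi, h0, h4, -⟩
      simp [Expr.eval, h0, h4])
    (s := (Cmd.assign 4 (.const 0)).final s)
    (by
      refine ⟨h.inp_eq, ?_, ?_, h.hist, fun v hv => ?_⟩
      · simp [Cmd.final, State.setReg, h.base]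
      · simp [Cmd.final, State.setReg, Expr.eval]
      · simpa [Cmd.final, State.setReg] using h.out v hv)
  refine ⟨s', (h1.seq hr).mono ?_, fun v hv => ?_⟩
  · simp [Cmd.size]
    omega
  · rw [hs' v hv, if_pos hv]

/-- The program of `Schedule`. -/
def scheduleProg : Cmd := .seq prepareProg (.seq (.loop (.reg 1) roundBody) outputProg)

/-- Hall's condition is absent: the program halts with a well-formed schedule in any case, and
success is read off from `AuctionState` afterwards. -/
theorem runs_scheduleProg {n q lam b : ℕ} {l Q : List ℕ}
    (hQ : IsQuery n q Q) (hl : ∀ v ∈ l, v < b) (hX : ∀ x < n, ∃ i < l.length, i % n = x) :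
    ∃ s' H k cur, Runs scheduleProg (State.start [[n, q, lam], table n l, Q]) s'
        (8 * q * (q + 2) * (l.length * 14 + 23) + 70 * q + 25) ∧
      AuctionState l.length b (· % n) (fun i => l.getD i 0) Q (8 * q * (q + 2)) H k cur ∧
      ∀ v < 8 * q, s'.arr v = scheduled l (H v) := by
  obtain ⟨s₁, hr₁, h₁⟩ := runs_prepareProg n q lam (table n l) Q
  obtain ⟨s₂, hr₂, f, H, k, cur, -, h₂, ha⟩ := runs_loop (e := .reg 1) (c := roundBody)
    (t := l.length * 14 + 22) (fun r s => ∃ f H k cur, f = 8 * q * (q + 2) - r ∧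
      Represents s [[n, q, lam], table n l, Q] (8 * q) f H k cur ∧
      AuctionState l.length b (· % n) (fun i => l.getD i 0) Q r H k cur) (8 * q * (q + 2))
    (by
      rintro r s hr ⟨f, H, k, cur, hf, h, ha⟩
      obtain ⟨f, rfl⟩ : ∃ f', f = f' + 1 := ⟨f - 1, by omega⟩
      obtain ⟨s', H', k', cur', hrun, h', ha'⟩ := runs_roundBody hQ hl hX h ha
      exact ⟨by simp [Expr.eval, h.fuel], s', hrun, f, H', k', cur', by omega, h', ha'⟩)
    (by
      rintro s ⟨f, H, k, cur, hf, h, ha⟩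
      simp [Expr.eval, h.fuel, hf])
    ⟨_, _, _, _, rfl, h₁, auctionState_start b⟩
  obtain ⟨s₃, hr₃, h₃⟩ := runs_outputProg rfl h₂ fun v i hi => (ha.edge v i hi).1
  refine ⟨s₃, H, k, cur, (hr₁.seq (hr₂.seq hr₃)).mono ?_, ha, h₃⟩
  have : l.length * 14 + 22 + 1 = l.length * 14 + 23 := rfl
  rw [this]
  omega

/-! ## Decoding -/

/-- The bucket of the edge in register `1`. -/
def Expr.edgeBucket : Expr := .input 1 (.add (.reg 1) (.const 1))

/-- The number of the input array with the scheduled positions of the bucket of the edge in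
register `1`. -/
def Expr.schedOf : Expr := .add (.add (.const 3) .edgeBucket) .edgeBucket

/-- The number of the input array with the codewords of the bucket of the edge in
register `1`. -/
def Expr.wordsOf : Expr := .add (.add (.const 4) .edgeBucket) .edgeBucket

/-- The loop body of the search for a scheduled edge of the item with number in register `0`:
the codeword of such an edge is copied to register `2`. -/
def lookupBody : Cmd := block
  [.ite (.sub (.input 1 (.reg 1)) (.input 2 (.reg 0))) .skip
    (.ite (.sub (.input 2 (.reg 0)) (.input 1 (.reg 1))) .skip
      (.ite (.inLen .schedOf)
        (.ite (.sub (.inGet .schedOf (.const 0)) (.input 1 (.add (.reg 1) (.const 2)))) .skip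
          (.ite (.sub (.input 1 (.add (.reg 1) (.const 2))) (.inGet .schedOf (.const 0))) .skip
            (.assign 2 (.inGet .wordsOf (.const 0)))))
        .skip)),
   .assign 1 (.add (.reg 1) (.const 3))]

/-- The search for a scheduled edge. -/
def lookupLoop : Cmd := .loop (.sub (.inLen (.const 1)) (.reg 1)) lookupBody

/-- Edge `i` belongs to item `x` and is scheduled in its bucket. -/
def IsScheduled (n : ℕ) (l : List ℕ) (inp : List (List ℕ)) (x i : ℕ) : Prop :=
  -- Arrays 0, 1, 2 are the numbers, the table and the query. After them positions and codewords
  -- alternate, so bucket `v` owns the arrays `3 + v + v` and `4 + v + v`.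
  i % n = x ∧ (inp.getD (3 + l.getD i 0 + l.getD i 0) []).length ≠ 0 ∧
    (inp.getD (3 + l.getD i 0 + l.getD i 0) []).getD 0 0 = rank l i

/-- Register `2` keeps the word of the last scheduled edge met, hence the premise that all such
edges give the same `y`. Without such an edge it keeps a stale word, hence the premise of existence.
Halting needs neither. -/
theorem runs_lookupLoop {n : ℕ} {l Q : List ℕ} {inp : List (List ℕ)}
    (hinp : inp.getD 1 [] = table n l) (hQ : inp.getD 2 [] = Q) {k y : ℕ} {A : ℕ → List ℕ}
    {s : State} (hi : s.inp = inp) (hA : s.arr = A) (h0 : s.reg 0 = k) (h1 : s.reg 1 = 0) :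
    ∃ s', Runs lookupLoop s s' (l.length * 16 + 1) ∧ s'.inp = inp ∧ s'.arr = A ∧ s'.reg 0 = k ∧
      ((∀ i < l.length, IsScheduled n l inp (Q.getD k 0) i →
          (inp.getD (4 + l.getD i 0 + l.getD i 0) []).getD 0 0 = y) →
        (∃ i < l.length, IsScheduled n l inp (Q.getD k 0) i) → s'.reg 2 = y) := by
  refine (runs_loop (t := 15) (fun m s => s.inp = inp ∧ s.arr = A ∧ s.reg 0 = k ∧
      s.reg 1 = 3 * m ∧
      ((∀ i < l.length, IsScheduled n l inp (Q.getD k 0) i →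
          (inp.getD (4 + l.getD i 0 + l.getD i 0) []).getD 0 0 = y) →
        (∃ i < m, IsScheduled n l inp (Q.getD k 0) i) → s.reg 2 = y))
    l.length ?_ ?_ ?_).imp fun s' h => ⟨h.1, h.2.1, h.2.2.1, h.2.2.2.1, h.2.2.2.2.2⟩
  · rintro m s hm ⟨hi, hA, h0, h1, h2⟩
    refine ⟨?_, _, runs_of_straight rfl s, ?_⟩
    · simp [Expr.eval, hi, h1, length_table, hinp, -List.getD_eq_getElem?_getD]
      omega
    · by_cases hg : IsScheduled n l inp (Q.getD k 0) m
      · obtain ⟨g1, g2, g3⟩ := id hg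
        have hfin : lookupBody.final s = (s.setReg 2 ((inp.getD
            (4 + l.getD m 0 + l.getD m 0) []).getD 0 0)).setReg 1 (3 * (m + 1)) := by
          simp only [lookupBody, block, Cmd.final, State.setReg, Expr.eval, Expr.input,
            Expr.schedOf, Expr.wordsOf, Expr.edgeBucket, hi, hinp, hQ, h0, h1, table_item hm,
            table_bucket hm, table_rank hm, g1, g2, g3, tsub_self, ne_eq, not_true_eq_false,
            not_false_eq_true, if_true, if_false]
          simp [h1, mul_add]
        rw [hfin]
        refine ⟨hi, hA, by simp [State.setReg, h0], by simp [State.setReg], fun h _ => ?_⟩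
        simpa [State.setReg] using h m hm hg
      · have hfin : lookupBody.final s = s.setReg 1 (3 * (m + 1)) := by
          have aux : ∀ a b : ℕ, a < b → (b - a = 0) = False := fun a b h => by
            simp; omega
          have aux' : ∀ a b : ℕ, a < b → a - b = 0 := fun a b h => by omega
          rcases lt_trichotomy (m % n) (Q.getD k 0) with h | h | h
          · simp only [lookupBody, block, Cmd.final, State.setReg, Expr.eval, Expr.input,
              Expr.schedOf, Expr.wordsOf, Expr.edgeBucket, hi, hinp, hQ, h0, h1, table_item hm,
              aux _ _ h, aux' _ _ h, ne_eq, not_true_eq_false, not_false_eq_true, if_true,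
              if_false]
            simp [mul_add]
          · by_cases h' : (inp.getD (3 + l.getD m 0 + l.getD m 0) []).length = 0
            · simp only [lookupBody, block, Cmd.final, State.setReg, Expr.eval, Expr.input,
                Expr.schedOf, Expr.wordsOf, Expr.edgeBucket, hi, hinp, hQ, h0, h1, table_item hm,
                table_bucket hm, h, h', tsub_self, ne_eq, not_true_eq_false, not_false_eq_true,
                if_true, if_false]
              simp [mul_add]
            · rcases lt_trichotomy ((inp.getD (3 + l.getD m 0 + l.getD m 0) []).getD 0 0)
                (rank l m) with h'' | h'' | h''
              · simp only [lookupBody, block, Cmd.final, State.setReg, Expr.eval, Expr.input,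
                  Expr.schedOf, Expr.wordsOf, Expr.edgeBucket, hi, hinp, hQ, h0, h1,
                  table_item hm, table_bucket hm, table_rank hm, h, h', aux _ _ h'', aux' _ _ h'',
                  tsub_self, ne_eq, not_true_eq_false, not_false_eq_true, if_true, if_false]
                simp [mul_add]
              · exact absurd ⟨h, h', h''⟩ hg
              · simp only [lookupBody, block, Cmd.final, State.setReg, Expr.eval, Expr.input,
                  Expr.schedOf, Expr.wordsOf, Expr.edgeBucket, hi, hinp, hQ, h0, h1,
                  table_item hm, table_bucket hm, table_rank hm, h, h', aux _ _ h'', aux' _ _ h'',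
                  tsub_self, ne_eq, not_true_eq_false, not_false_eq_true, if_true, if_false]
                simp [mul_add]
          · simp only [lookupBody, block, Cmd.final, State.setReg, Expr.eval, Expr.input,
              Expr.schedOf, Expr.wordsOf, Expr.edgeBucket, hi, hinp, hQ, h0, h1, table_item hm,
              aux _ _ h, aux' _ _ h, ne_eq, not_true_eq_false, not_false_eq_true, if_true,
              if_false]
            simp [mul_add]
        rw [hfin]
        refine ⟨hi, hA, by simp [State.setReg, h0], by simp [State.setReg], ?_⟩
        rintro h ⟨i, him, his⟩
        have him : i < m := by
          rcases Nat.lt_succ_iff_lt_or_eq.1 him with h' | rfl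
          · exact h'
          · exact absurd his hg
        simpa [State.setReg] using h2 h ⟨i, him, his⟩
  · rintro s ⟨hi, -, -, h1, -⟩
    simp [Expr.eval, hi, h1, length_table, hinp, -List.getD_eq_getElem?_getD]
  · exact ⟨hi, hA, h0, h1, by simp⟩

/-- The loop body of `Decode`. -/
def decodeBody : Cmd := .seq (.assign 1 (.const 0)) (.seq lookupLoop
  (block [.push (.const 0) (.reg 2), .assign 0 (.add (.reg 0) (.const 1))]))

/-- The program of `Decode`. -/
def decodeProg : Cmd := .loop (.sub (.input 0 (.const 1)) (.reg 0)) decodeBody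

theorem runs_decodeProg {n q lam : ℕ} {l Q DB : List ℕ} {inp : List (List ℕ)}
    (hpar : inp.getD 0 [] = [n, q, lam]) (hinp : inp.getD 1 [] = table n l)
    (hQ : inp.getD 2 [] = Q) (hq : Q.length = q) :
    ∃ s', Runs decodeProg (State.start inp) s' (q * (l.length * 16 + 10) + 1) ∧
      ((∀ x ∈ Q, (∀ i < l.length, IsScheduled n l inp x i →
          (inp.getD (4 + l.getD i 0 + l.getD i 0) []).getD 0 0 = DB.getD x 0) ∧
        (∃ i < l.length, IsScheduled n l inp x i)) → s'.arr 0 = answers DB Q) := by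
  refine (runs_loop (t := l.length * 16 + 9) (fun k s => s.inp = inp ∧ s.reg 0 = k ∧
      ((∀ x ∈ Q, (∀ i < l.length, IsScheduled n l inp x i →
          (inp.getD (4 + l.getD i 0 + l.getD i 0) []).getD 0 0 = DB.getD x 0) ∧
        (∃ i < l.length, IsScheduled n l inp x i)) →
          s.arr 0 = answers DB (Q.take k))) q ?_ ?_ ?_).imp fun s' h => ⟨h.1, ?_⟩
  · rintro k s hk ⟨hi, h0, hA⟩
    constructor
    · simp [Expr.eval, Expr.input, hi, hpar, h0, -List.getD_eq_getElem?_getD]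
      simp
      omega
    obtain ⟨s', hr, hi', hA', h0', hy⟩ := runs_lookupLoop hinp hQ (k := k)
      (y := DB.getD (Q.getD k 0) 0) (s := s.setReg 1 0) hi rfl (by simp [State.setReg, h0])
      (by simp [State.setReg])
    refine ⟨_, ((runs_of_straight (c := .assign 1 (.const 0)) rfl s).seq
      (hr.seq (runs_of_straight rfl s'))).mono ?_, ?_, ?_, fun h => ?_⟩
    · simp only [Cmd.size, block]
      omega
    · simp [block, Cmd.final, State.setReg, State.setArr, hi']
    · simp [block, Cmd.final, State.setReg, State.setArr, Expr.eval, h0']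
    · have hkQ : k < Q.length := by omega
      have hmem : Q.getD k 0 ∈ Q := by
        rw [List.getD_eq_getElem _ _ hkQ]
        exact List.getElem_mem _
      have hy := hy (h _ hmem).1 (h _ hmem).2
      have hA := hA h
      trans s'.arr 0 ++ [s'.reg 2]
      · simp [block, Cmd.final, State.setReg, State.setArr, Expr.eval]
      · rw [hy, hA', show (s.setReg 1 0).arr = s.arr from rfl, hA, answers, answers,
          List.take_add_one, List.getElem?_eq_getElem hkQ, List.getD_eq_getElem _ _ hkQ,
          List.map_append]
        rfl
  · rintro s ⟨hi, h0, -⟩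
    simp [Expr.eval, Expr.input, hi, hpar, h0, -List.getD_eq_getElem?_getD]
    simp
  · refine ⟨rfl, rfl, fun _ => ?_⟩
    simp [State.start, answers]
  · intro h'
    have := h.2.2.2 h'
    rwa [← hq, List.take_length] at this

/-! ## Initialization -/

theorem State.eq_of {s s' : State} (hi : s.inp = s'.inp) (hr : ∀ r, s.reg r = s'.reg r)
    (ha : ∀ a, s.arr a = s'.arr a) : s = s' := by
  cases s
  cases s'
  simp only [State.mk.injEq]
  exact ⟨hi, funext hr, funext ha⟩

theorem runsIn_flip (x : ℕ) (s : State) :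
    RunsIn (.flip x) s 1 ((PMF.uniformOfFintype Bool).map fun β => s.setReg x β.toNat) := by
  intro T K
  rw [run, PMF.bind_map]
  rfl

/-- The distribution of the number that is obtained from `v` by appending `j` random bits. -/
noncomputable def appendBits : ℕ → ℕ → PMF ℕ
  | 0, v => PMF.pure v
  | j + 1, v => (PMF.uniformOfFintype Bool).bind fun β => appendBits j (v + v + β.toNat)

/-- The distribution of `k` independent random numbers of `ell` bits. -/
noncomputable def samples (ell : ℕ) : ℕ → PMF (List ℕ)
  | 0 => PMF.pure []
  | k + 1 => (appendBits ell 0).bind fun v => (samples ell k).map (v :: ·)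

/-- The loop body that appends a random bit to register `4`. -/
def bitBody : Cmd := .seq (.flip 6) (block
  [.assign 4 (.add (.add (.reg 4) (.reg 4)) (.reg 6)), .assign 6 (.const 0),
   .assign 5 (.sub (.reg 5) (.const 1))])

/-- The state while a number is sampled: `v` is its present value, `j` bits are missing. -/
def State.sampling (s : State) (v j : ℕ) : State :=
  ((s.setReg 4 v).setReg 5 j).setReg 6 0

/-- A pass takes 9 steps whatever the coin shows. Register `6` is cleared in each pass, so the state
depends on the value and the number of missing bits alone. -/
theorem runsIn_bitLoop (s : State) (j v : ℕ) :
    RunsIn (.loop (.reg 5) bitBody) (s.sampling v j) (j * 10 + 1)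
      ((appendBits j v).map fun w => s.sampling w 0) := by
  induction j generalizing v with
  | zero =>
    rw [appendBits, PMF.pure_map]
    exact runsIn_loop_false (by simp [Expr.eval, State.sampling, State.setReg])
  | succ j ih =>
    have hbody : RunsIn bitBody (s.sampling v (j + 1)) 9 ((PMF.uniformOfFintype Bool).map
        fun β => s.sampling (v + v + β.toNat) j) := by
      have := (runsIn_flip 6 (s.sampling v (j + 1))).seq_bind (d := block
        [.assign 4 (.add (.add (.reg 4) (.reg 4)) (.reg 6)), .assign 6 (.const 0),
          .assign 5 (.sub (.reg 5) (.const 1))]) (t' := 7)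
        (μ := fun β => PMF.pure (s.sampling (v + v + β.toNat) j)) (fun β => by
          have e : (block [.assign 4 (.add (.add (.reg 4) (.reg 4)) (.reg 6)),
              .assign 6 (.const 0), .assign 5 (.sub (.reg 5) (.const 1))]).final
                ((s.sampling v (j + 1)).setReg 6 β.toNat) =
              s.sampling (v + v + β.toNat) j := by
            refine State.eq_of rfl (fun r => ?_) fun _ => rfl
            simp only [State.sampling, State.setReg, block, Cmd.final, Expr.eval]
            by_cases h4 : r = 4
            · simp [h4]
            · by_cases h5 : r = 5
              · simp [h5]
              · by_cases h6 : r = 6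
                · simp [h6]
                · simp [h4, h5, h6]
          rw [← e]
          exact runsIn_of_straight rfl _)
      exact this
    have h := runsIn_loop_true (e := .reg 5) (by simp [Expr.eval, State.sampling, State.setReg])
      hbody (fun β => ih (v + v + β.toNat))
    rw [appendBits, PMF.map_bind]
    have e : 9 + (j * 10 + 1) + 1 = (j + 1) * 10 + 1 := by ring
    rwa [e] at h

/-- Recording the edge to the bucket in register `4`. -/
def recordCmd : Cmd := block
  [.push (.const 0) (.reg 3), .push (.const 0) (.reg 4),
   -- Array `1 + v` is a unary counter of the edges to bucket `v`; its length before the next push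
   -- is the rank of the new edge.
   .push (.const 0) (.len (.add (.const 1) (.reg 4))),
   .push (.add (.const 1) (.reg 4)) (.const 0),
   .assign 3 (.add (.reg 3) (.const 1)),
   -- The item number modulo `n` without division: the counter is reset when it reaches `n`.
   .ite (.sub (.input 0 (.const 0)) (.reg 3)) .skip (.assign 3 (.const 0)),
   .assign 4 (.const 0), .assign 0 (.sub (.reg 0) (.const 1))]

/-- The state of `Init` after the buckets in `l` have been sampled. -/
def State.sampled (s : State) (n m : ℕ) (l : List ℕ) : State where
  inp := s.inp
  reg := Function.update (Function.update s.reg 0 (m - l.length)) 3 (l.length % n)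
  arr := fun a => if a = 0 then table n l else List.replicate (l.count (a - 1)) 0

theorem succ_mod_eq (a : ℕ) {n : ℕ} (hn : 0 < n) :
    (a + 1) % n = if n - (a % n + 1) ≠ 0 then a % n + 1 else 0 := by
  have h := Nat.mod_lt a hn
  rw [← Nat.mod_add_mod]
  split_ifs with h'
  · exact Nat.mod_eq_of_lt (by omega)
  · have : a % n + 1 = n := by omega
    rw [this, Nat.mod_self]

/-- Both branches of the conditional cost one step, which gives the exact count that random loops
require. -/
theorem steps_recordCmd (s : State) : recordCmd.steps s = 18 := by
  simp [recordCmd, block, Cmd.steps]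

theorem final_recordCmd {s : State} {n m : ℕ} (hn : 0 < n) (l : List ℕ) (w : ℕ)
    (hinp : (s.inp.getD 0 []).getD 0 0 = n) (h4 : s.reg 4 = 0) (h5 : s.reg 5 = 0)
    (h6 : s.reg 6 = 0) :
    recordCmd.final ((s.sampled n m l).sampling w 0) = s.sampled n m (l ++ [w]) := by
  have hmod := succ_mod_eq l.length hn
  have key : recordCmd.final ((s.sampled n m l).sampling w 0) =
      ((((((s.sampled n m l).sampling w 0).setArr 0
        (table n l ++ [l.length % n, w, l.count w])).setArr (1 + w)
        (List.replicate (l.count w) 0 ++ [0])).setReg 3 ((l.length + 1) % n)).setReg 4 0).setReg 0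
        (m - (l.length + 1)) := by
    by_cases hc : n - (l.length % n + 1) = 0 <;>
    · simp only [hc, ne_eq, not_true_eq_false, not_false_eq_true, if_false, if_true] at hmod
      rw [hmod]
      refine State.eq_of ?_ (fun r => ?_) (fun a => ?_) <;>
      simp [recordCmd, block, Cmd.final, State.sampled, State.sampling, State.setReg,
        State.setArr, Expr.eval, Expr.input, hinp, hc, Nat.sub_sub, -List.getD_eq_getElem?_getD]
  rw [key]
  refine State.eq_of rfl (fun r => ?_) (fun a => ?_)
  · simp only [State.sampled, State.sampling, State.setReg, State.setArr]
    by_cases r0 : r = 0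
    · simp [r0]
    by_cases r3 : r = 3
    · simp [r3]
    by_cases r4 : r = 4
    · simp [r4, h4]
    by_cases r5 : r = 5
    · simp [r5, h5]
    by_cases r6 : r = 6
    · simp [r6, h6]
    simp [r0, r3, r4, r5, r6]
  · simp only [State.sampled, State.sampling, State.setReg, State.setArr]
    by_cases a0 : a = 0
    · have : 0 ≠ 1 + w := by omega
      simp [a0, this, table_concat]
    by_cases a1 : a = 1 + w
    · simp [a1, ← List.replicate_succ']
    · have : ¬ w = a - 1 := by omega
      simp [a0, a1, List.count_singleton, this]

/-- The loop body of `Init`: sample a bucket and record the edge. -/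
def sampleBody : Cmd := .seq (block [.assign 4 (.const 0), .assign 5 (.reg 2)])
  (.seq (.loop (.reg 5) bitBody) recordCmd)

theorem runsIn_sampleBody {s : State} {n m ell : ℕ} (hn : 0 < n) (l : List ℕ)
    (hinp : (s.inp.getD 0 []).getD 0 0 = n) (h2 : s.reg 2 = ell) (h4 : s.reg 4 = 0)
    (h5 : s.reg 5 = 0) (h6 : s.reg 6 = 0) :
    RunsIn sampleBody (s.sampled n m l) (ell * 10 + 26)
      ((appendBits ell 0).map fun w => s.sampled n m (l ++ [w])) := by
  have hstart : (block [.assign 4 (.const 0), .assign 5 (.reg 2)]).final (s.sampled n m l) =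
      (s.sampled n m l).sampling 0 ell := by
    refine State.eq_of rfl (fun r => ?_) fun _ => rfl
    simp only [State.sampling, State.setReg, State.sampled, block, Cmd.final, Expr.eval]
    by_cases r6 : r = 6
    · simp [r6, h6]
    by_cases r5 : r = 5
    · simp [r5, h2]
    simp [r5, r6]
  have h := (runsIn_of_straight (c := block [.assign 4 (.const 0), .assign 5 (.reg 2)]) rfl
    (s.sampled n m l)).seq (hstart ▸ (runsIn_bitLoop (s.sampled n m l) ell 0).seq_bind
      (fun w => steps_recordCmd ((s.sampled n m l).sampling w 0) ▸
        runsIn_of_straight (c := recordCmd) rfl ((s.sampled n m l).sampling w 0)))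
  simp only [final_recordCmd hn l _ hinp h4 h5 h6] at h
  have e : (block [.assign 4 (.const 0), .assign 5 (.reg 2)]).steps (s.sampled n m l) +
      (ell * 10 + 1 + 18 + 1) + 1 = ell * 10 + 26 := by
    simp only [block, Cmd.steps]
    omega
  rwa [e] at h

theorem runsIn_sampleLoop {s : State} {n m ell : ℕ} (hn : 0 < n)
    (hinp : (s.inp.getD 0 []).getD 0 0 = n) (h2 : s.reg 2 = ell) (h4 : s.reg 4 = 0)
    (h5 : s.reg 5 = 0) (h6 : s.reg 6 = 0) (k : ℕ) (l : List ℕ) (hl : l.length + k = m) :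
    RunsIn (.loop (.reg 0) sampleBody) (s.sampled n m l) (k * (ell * 10 + 27) + 1)
      ((samples ell k).map fun l' => s.sampled n m (l ++ l')) := by
  induction k generalizing l with
  | zero =>
    rw [samples, PMF.pure_map, List.append_nil]
    rw [zero_mul, zero_add]
    refine runsIn_loop_false ?_
    simp [Expr.eval, State.sampled]
    omega
  | succ k ih =>
    have h := runsIn_loop_true (e := .reg 0) (by simp [Expr.eval, State.sampled]; omega)
      (runsIn_sampleBody (m := m) hn l hinp h2 h4 h5 h6)
      (fun w => ih (l ++ [w]) (by simp; omega))
    have e : ell * 10 + 26 + (k * (ell * 10 + 27) + 1) + 1 = (k + 1) * (ell * 10 + 27) + 1 := by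
      ring
    rw [e] at h
    rw [samples, PMF.map_bind]
    simpa [PMF.map_comp, Function.comp_def] using h

/-- Three times the number of items. -/
def Expr.threeN : Expr :=
  .add (.add (.input 0 (.const 0)) (.input 0 (.const 0))) (.input 0 (.const 0))

/-- Computation of the number of edges in register `0` and of the bit length of bucket numbers
in register `2`. -/
def paramProg : Cmd := .seq (.seq (.assign 1 (.const 1))
    (.loop (.sub (.input 0 (.const 0)) (.reg 1)) (block [.assign 1 (.add (.reg 1) (.reg 1)),
      .assign 0 (.add (.reg 0) .threeN)])))
  (.seq (.seq (.assign 1 (.input 0 (.const 2)))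
    (.loop (.reg 1) (block [.assign 1 (.sub (.reg 1) (.const 1)),
      .assign 0 (.add (.reg 0) .threeN)])))
  (.seq (.assign 1 (.const 1))
    (.loop (.sub (.add (.add (.input 0 (.const 1)) (.input 0 (.const 1)))
        (.add (.input 0 (.const 1)) (.input 0 (.const 1)))) (.reg 1))
      (block [.assign 1 (.add (.reg 1) (.reg 1)), .assign 2 (.add (.reg 2) (.const 1))]))))

/-- The number of edges. -/
def edges (n lam : ℕ) : ℕ := 3 * n * (Nat.clog 2 n + lam)

/-- The bit length of bucket numbers. -/
def bucketBits (q : ℕ) : ℕ := Nat.clog 2 (4 * q)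

/-- Rounded-up logarithms are found by doubling register `1` until it reaches the target. Each
doubling for `n`, and then each unit of `lam`, adds `3 * n` to register `0`, which produces the
product in `edges`. -/
theorem runs_paramProg (n q lam : ℕ) :
    ∃ s', Runs paramProg (State.start [[n, q, lam]])
      s' ((Nat.clog 2 n + lam + bucketBits q) * 6 + 11) ∧ s'.inp = [[n, q, lam]] ∧
      s'.arr = (fun _ => []) ∧ s'.reg 0 = edges n lam ∧ s'.reg 2 = bucketBits q ∧
      s'.reg 3 = 0 ∧ s'.reg 4 = 0 ∧ s'.reg 5 = 0 ∧ s'.reg 6 = 0 := by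
  have hpow : ∀ k a, 2 ^ k < a ↔ k < Nat.clog 2 a := fun k a => by
    rw [Nat.lt_clog_iff_pow_lt (by norm_num)]
  obtain ⟨s₁, hr₁, hi₁, ha₁, h1₁, h0₁, h2₁, h3₁⟩ := runs_loop
    (e := .sub (.input 0 (.const 0)) (.reg 1))
    (c := block [.assign 1 (.add (.reg 1) (.reg 1)), .assign 0 (.add (.reg 0) .threeN)])
    (t := 5) (fun k s => s.inp = [[n, q, lam]] ∧ s.arr = (fun _ => []) ∧ s.reg 1 = 2 ^ k ∧
      s.reg 0 = 3 * n * k ∧ s.reg 2 = 0 ∧ s.reg 3 = 0 ∧ s.reg 4 = 0 ∧ s.reg 5 = 0 ∧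
      s.reg 6 = 0) (Nat.clog 2 n)
    (by
      rintro k s hk ⟨hi, ha, h1, h0, h2, h3, h4, h5, h6⟩
      rw [← hpow] at hk
      refine ⟨by simp [Expr.eval, Expr.input, hi, h1]; omega, _, runs_of_straight rfl s, ?_⟩
      simp [block, Cmd.final, State.setReg, Expr.eval, Expr.input, Expr.threeN, hi, ha, h1, h0,
        h2, h3, h4, h5, h6]
      constructor <;> ring)
    (by
      rintro s ⟨hi, ha, h1, -⟩
      have := Nat.le_pow_clog (by norm_num : 1 < 2) n
      simp [Expr.eval, Expr.input, hi, h1]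
      omega)
    (s := (State.start [[n, q, lam]]).setReg 1 1)
    (by simp [State.start, State.setReg])
  obtain ⟨s₂, hr₂, hi₂, ha₂, -, h0₂, h2₂, h3₂⟩ := runs_loop
    (e := .reg 1)
    (c := block [.assign 1 (.sub (.reg 1) (.const 1)), .assign 0 (.add (.reg 0) .threeN)])
    (t := 5) (fun k s => s.inp = [[n, q, lam]] ∧ s.arr = (fun _ => []) ∧ s.reg 1 = lam - k ∧
      s.reg 0 = 3 * n * (Nat.clog 2 n + k) ∧ s.reg 2 = 0 ∧ s.reg 3 = 0 ∧ s.reg 4 = 0 ∧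
      s.reg 5 = 0 ∧ s.reg 6 = 0) lam
    (by
      rintro k s hk ⟨hi, ha, h1, h0, h2, h3, h4, h5, h6⟩
      refine ⟨by simp [Expr.eval, h1]; omega, _, runs_of_straight rfl s, ?_⟩
      simp [block, Cmd.final, State.setReg, Expr.eval, Expr.input, Expr.threeN, hi, ha, h1, h0,
        h2, h3, h4, h5, h6, Nat.sub_sub]
      ring)
    (by
      rintro s ⟨hi, ha, h1, -⟩
      simp [Expr.eval, h1])
    (s := s₁.setReg 1 lam)
    (by simp [State.setReg, hi₁, ha₁, h0₁, h2₁, h3₁])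
  obtain ⟨s₃, hr₃, hi₃, ha₃, -, h0₃, h2₃, h3₃⟩ := runs_loop
    (e := .sub (.add (.add (.input 0 (.const 1)) (.input 0 (.const 1)))
        (.add (.input 0 (.const 1)) (.input 0 (.const 1)))) (.reg 1))
    (c := block [.assign 1 (.add (.reg 1) (.reg 1)), .assign 2 (.add (.reg 2) (.const 1))])
    (t := 5) (fun k s => s.inp = [[n, q, lam]] ∧ s.arr = (fun _ => []) ∧ s.reg 1 = 2 ^ k ∧
      s.reg 0 = edges n lam ∧ s.reg 2 = k ∧ s.reg 3 = 0 ∧ s.reg 4 = 0 ∧ s.reg 5 = 0 ∧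
      s.reg 6 = 0) (bucketBits q)
    (by
      rintro k s hk ⟨hi, ha, h1, h0, h2, h3, h4, h5, h6⟩
      rw [bucketBits, ← hpow] at hk
      refine ⟨by simp [Expr.eval, Expr.input, hi, h1]; omega, _, runs_of_straight rfl s, ?_⟩
      simp [block, Cmd.final, State.setReg, Expr.eval, Expr.input, hi, ha, h1, h0,
        h2, h3, h4, h5, h6]
      ring)
    (by
      rintro s ⟨hi, ha, h1, -⟩
      have := Nat.le_pow_clog (by norm_num : 1 < 2) (4 * q)
      simp [Expr.eval, Expr.input, hi, h1, bucketBits]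
      omega)
    (s := s₂.setReg 1 1)
    (by simp [State.setReg, hi₂, ha₂, h0₂, h2₂, h3₂, edges])
  refine ⟨s₃, Runs.mono (((?_ : Runs _ _ _ 1).seq hr₁).seq (((?_ : Runs _ _ _ 1).seq hr₂).seq
    ((?_ : Runs _ _ _ 1).seq hr₃))) ?_, hi₃, ha₃, h0₃, h2₃, h3₃⟩
  · exact runs_of_straight (c := .assign 1 (.const 1)) rfl _
  · have := runs_of_straight (c := .assign 1 (.input 0 (.const 2))) rfl s₁
    simpa [Cmd.final, Cmd.size, Expr.eval, Expr.input, hi₁] using this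
  · exact runs_of_straight (c := .assign 1 (.const 1)) rfl _
  · omega

/-- The program of `Init`. -/
def initProg : Cmd := .seq paramProg (.loop (.reg 0) sampleBody)

theorem exec_initProg {n : ℕ} (hn : 0 < n) (q lam : ℕ) {T : ℕ}
    (hT : (Nat.clog 2 n + lam + bucketBits q) * 6 + edges n lam * (bucketBits q * 10 + 27) + 13
      ≤ T) :
    (initProg.exec T [[n, q, lam]]).map (Option.map fun r => r 0) =
      (samples (bucketBits q) (edges n lam)).map fun l => some (table n l) := by
  obtain ⟨s, ⟨t, ht, hr⟩, hi, ha, h0, h2, h3, h4, h5, h6⟩ := runs_paramProg n q lam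
  have hs : s.sampled n (edges n lam) [] = s := by
    refine State.eq_of rfl (fun r => ?_) fun a => ?_
    · simp only [State.sampled]
      by_cases r0 : r = 0
      · simp [r0, h0]
      by_cases r3 : r = 3
      · simp [r3, h3]
      simp [r0, r3]
    · simp [State.sampled, ha, table]
  have h := runsIn_sampleLoop (s := s) (m := edges n lam) hn (by rw [hi]; rfl) h2 h4 h5 h6
    (edges n lam) [] (by simp)
  rw [hs] at h
  rw [initProg, exec_eq_map (hr.seq h) (by omega), PMF.map_comp]
  simp [Function.comp_def, State.sampled]

/-! ## Random edges satisfy Hall's condition -/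

theorem mem_support_appendBits {j v w : ℕ} (h : w ∈ (appendBits j v).support) :
    v * 2 ^ j ≤ w ∧ w < (v + 1) * 2 ^ j := by
  induction j generalizing v with
  | zero =>
    rw [appendBits, PMF.mem_support_pure_iff] at h
    omega
  | succ j ih =>
    rw [appendBits, PMF.mem_support_bind_iff] at h
    obtain ⟨β, -, h⟩ := h
    have := ih h
    rw [pow_succ]
    cases β <;> simp only [Bool.toNat_false, Bool.toNat_true] at this <;>
      constructor <;> nlinarith [Nat.zero_le (2 ^ j)]

/-- The two values of the first bit lead to disjoint intervals of results, so at most one of the two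
summands is nonzero. -/
theorem appendBits_apply_le (j v w : ℕ) : appendBits j v w ≤ 2⁻¹ ^ j := by
  induction j generalizing v with
  | zero => simpa using PMF.coe_le_one _ _
  | succ j ih =>
    rw [appendBits, PMF.bind_apply, tsum_fintype, Fintype.sum_bool]
    simp only [PMF.uniformOfFintype_apply, Fintype.card_bool, Nat.cast_ofNat, Bool.toNat_false,
      Bool.toNat_true]
    rw [pow_succ']
    by_cases h0 : appendBits j (v + v + 0) w = 0
    · rw [h0, mul_zero, add_zero]
      gcongr
      exact ih _
    · have h1 : appendBits j (v + v + 1) w = 0 := by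
        by_contra h1
        have a0 := mem_support_appendBits ((PMF.mem_support_iff _ _).2 h0)
        have a1 := mem_support_appendBits ((PMF.mem_support_iff _ _).2 h1)
        have := a0.2
        have := a1.1
        simp only [add_zero] at *
        omega
      rw [h1, mul_zero, zero_add]
      gcongr
      exact ih _

theorem appendBits_finset_le (j v : ℕ) (T : Finset ℕ) :
    (appendBits j v).toOuterMeasure T ≤ T.card * 2⁻¹ ^ j := by
  rw [PMF.toOuterMeasure_apply_finset, ← nsmul_eq_mul]
  exact Finset.sum_le_card_nsmul _ _ _ fun w _ => appendBits_apply_le j v w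

theorem mem_support_samples {ell k : ℕ} {l : List ℕ} (h : l ∈ (samples ell k).support) :
    l.length = k ∧ ∀ v ∈ l, v < 2 ^ ell := by
  induction k generalizing l with
  | zero =>
    rw [samples, PMF.mem_support_pure_iff] at h
    simp [h]
  | succ k ih =>
    rw [samples, PMF.mem_support_bind_iff] at h
    obtain ⟨v, hv, h⟩ := h
    rw [PMF.mem_support_map_iff] at h
    obtain ⟨l', hl', rfl⟩ := h
    have := ih hl'
    have hv := (mem_support_appendBits hv).2
    simp only [zero_add, one_mul] at hv
    simpa [this.1, hv] using this.2

theorem toOuterMeasure_le_one {α : Type*} (p : PMF α) (s : Set α) : p.toOuterMeasure s ≤ 1 := by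
  rw [PMF.toOuterMeasure_apply, ← p.tsum_coe]
  exact ENNReal.tsum_le_tsum fun x => Set.indicator_le_self _ _ _

/-- Independence in the one-sided form that a union bound needs: peel off the first sample and shift
the families `A` and `p`. -/
theorem samples_forall_le (ell k : ℕ) (A : ℕ → Set ℕ) (p : ℕ → ℝ≥0∞)
    (hA : ∀ i, (appendBits ell 0).toOuterMeasure (A i) ≤ p i) :
    (samples ell k).toOuterMeasure {l | ∀ i < k, l.getD i 0 ∈ A i} ≤
      ∏ i ∈ Finset.range k, p i := by
  induction k generalizing A p with
  | zero => simpa using toOuterMeasure_le_one _ _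
  | succ k ih =>
    rw [samples, PMF.toOuterMeasure_bind_apply, Finset.prod_range_succ']
    calc ∑' v, appendBits ell 0 v * ((samples ell k).map (v :: ·)).toOuterMeasure
          {l | ∀ i < k + 1, l.getD i 0 ∈ A i}
        ≤ ∑' v, (A 0).indicator (appendBits ell 0) v *
          ∏ i ∈ Finset.range k, p (i + 1) := by
          refine ENNReal.tsum_le_tsum fun v => ?_
          rw [PMF.toOuterMeasure_map_apply]
          by_cases hv : v ∈ A 0
          · rw [Set.indicator_of_mem hv]
            gcongr
            refine le_trans ?_ (ih (fun i => A (i + 1)) (fun i => p (i + 1)) fun i => hA _)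
            refine MeasureTheory.measure_mono ?_
            intro l hl i hi
            simpa using hl (i + 1) (by omega)
          · have : ((v :: ·) ⁻¹' {l : List ℕ | ∀ i < k + 1, l.getD i 0 ∈ A i}) = ∅ := by
              ext l
              simp only [Set.mem_preimage, Set.mem_ofPred_eq, Set.mem_empty_iff_false, iff_false]
              intro h
              exact hv (by simpa using h 0 (by omega))
            rw [this]
            simp
      _ ≤ (∏ i ∈ Finset.range k, p (i + 1)) * p 0 := by
          rw [ENNReal.tsum_mul_right, mul_comm, ← PMF.toOuterMeasure_apply]
          gcongr
          exact hA 0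

/-- The indices `x + n * j` with `x ∈ S` and `j < d` are distinct: every item has `d` edges. -/
theorem mul_card_le_card_filter_mod {n : ℕ} (d : ℕ) {S : Finset ℕ} (hS : S ⊆ Finset.range n) :
    d * S.card ≤ ((Finset.range (n * d)).filter fun i => i % n ∈ S).card := by
  rw [← Finset.card_range d, ← Finset.card_product]
  have hlt : ∀ x ∈ S, x < n := fun x hx => Finset.mem_range.1 (hS hx)
  refine Finset.card_le_card_of_injOn (fun y => y.2 + n * y.1) ?_ ?_
  · rintro ⟨j, x⟩ h
    simp only [Finset.coe_product, Set.mem_prod, Finset.mem_coe, Finset.mem_range,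
      Finset.card_range] at h
    have := hlt x h.2
    simp only [Finset.coe_filter, Finset.mem_range, Set.mem_ofPred_eq, Nat.add_mul_mod_self_left,
      Nat.mod_eq_of_lt this, h.2, and_true, Finset.card_range]
    nlinarith
  · rintro ⟨j, x⟩ h ⟨j', x'⟩ h' e
    simp only [Finset.coe_product, Set.mem_prod, Finset.mem_coe] at h h' e
    have hx := hlt x h.2
    have hx' := hlt x' h'.2
    have e1 := congrArg (· % n) e
    simp only [Nat.add_mul_mod_self_left, Nat.mod_eq_of_lt hx, Nat.mod_eq_of_lt hx'] at e1
    subst e1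
    have : n * j = n * j' := by omega
    rw [Nat.eq_of_mul_eq_mul_left (by omega) this]

/-- The probability that all edges of the items in `S` lead to buckets in `T`. -/
theorem samples_trapped_le {n q lam : ℕ} {S T : Finset ℕ} (hS : S ⊆ Finset.range n)
    (hT : T.card = S.card) (hq : S.card ≤ q) :
    (samples (bucketBits q) (edges n lam)).toOuterMeasure
      {l | ∀ i < edges n lam, i % n ∈ S → l.getD i 0 ∈ T} ≤
      2⁻¹ ^ (6 * (Nat.clog 2 n + lam) * S.card) := by
  -- A single edge hits `T` with probability at most 1/4, because there are at least `4 * q` buckets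
  -- and `T` has at most `q`.
  have h4 : (T.card : ℝ≥0∞) * 2⁻¹ ^ bucketBits q ≤ 2⁻¹ ^ 2 := by
    have h1 : T.card * 2 ^ 2 ≤ 2 ^ bucketBits q := by
      have := Nat.le_pow_clog (by norm_num : 1 < 2) (4 * q)
      rw [bucketBits]
      omega
    have h2 : (T.card : ℝ≥0∞) * 2 ^ 2 ≤ 2 ^ bucketBits q := by exact_mod_cast h1
    rw [← ENNReal.inv_pow, ← ENNReal.inv_pow, ← div_eq_mul_inv]
    refine ENNReal.div_le_of_le_mul ?_
    rw [mul_comm, ← div_eq_mul_inv, ENNReal.le_div_iff_mul_le (by simp) (by simp)]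
    exact h2
  -- Edges of items outside `S` are unconstrained and contribute a factor 1.
  refine (samples_forall_le _ _ (fun i => {v | i % n ∈ S → v ∈ T})
    (fun i => if i % n ∈ S then 2⁻¹ ^ 2 else 1) fun i => ?_).trans ?_
  · split_ifs with h
    · simp only [h, true_imp_iff]
      exact (appendBits_finset_le _ _ T).trans h4
    · exact toOuterMeasure_le_one _ _
  · rw [Finset.prod_ite, Finset.prod_const, Finset.prod_const_one, mul_one, ← pow_mul]
    refine pow_le_pow_right_of_le_one' (by simp) ?_
    have := mul_card_le_card_filter_mod (3 * (Nat.clog 2 n + lam)) hS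
    have e : n * (3 * (Nat.clog 2 n + lam)) = edges n lam := by rw [edges]; ring
    rw [e] at this
    nlinarith

/-- The edges allow a matching for every query of `q` items. -/
def IsGood (n q : ℕ) (l : List ℕ) : Prop :=
  ∀ Q : List ℕ, IsQuery n q Q → HallCondition l.length (· % n) (fun i => l.getD i 0) Q

/-- The neighbourhood of a set `S` violating Hall's condition is enlarged to a set `T` of the same
size. Such an `S` is nonempty, so its size can be written as `s + 1`. -/
theorem exists_trapped {n q m : ℕ} {l : List ℕ} (hl : l ∈ (samples (bucketBits q) m).support)
    (hbad : ¬ IsGood n q l) : ∃ s ∈ Finset.range q, ∃ S ∈ (Finset.range n).powersetCard (s + 1),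
      ∃ T ∈ (Finset.range (2 ^ bucketBits q)).powersetCard (s + 1),
        ∀ i < m, i % n ∈ S → l.getD i 0 ∈ T := by
  obtain ⟨hlen, hlt⟩ := mem_support_samples hl
  simp only [IsGood, HallCondition, not_forall, not_le] at hbad
  obtain ⟨Q, ⟨hQl, hQn, hQm⟩, S, hSQ, hS⟩ := hbad
  have hcard : S.card ≤ q := by
    rw [← hQl]
    exact (Finset.card_le_card hSQ).trans Q.toFinset_card_le
  have hq : q ≤ 2 ^ bucketBits q := by
    have := Nat.le_pow_clog (by norm_num : 1 < 2) (4 * q)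
    rw [bucketBits]
    omega
  obtain ⟨T, hT1, hT2, hT3⟩ := Finset.exists_subsuperset_card_eq
    (s := ((Finset.range l.length).filter fun i => i % n ∈ S).image fun i => l.getD i 0)
    (t := Finset.range (2 ^ bucketBits q)) (n := S.card) (by
      intro v hv
      obtain ⟨i, hi, rfl⟩ := Finset.mem_image.1 hv
      rw [Finset.mem_filter, Finset.mem_range] at hi
      rw [Finset.mem_range, List.getD_eq_getElem _ _ hi.1]
      exact hlt _ (List.getElem_mem _)) hS.le (by simpa using hcard.trans hq)
  obtain ⟨s, hs⟩ : ∃ s, S.card = s + 1 := ⟨S.card - 1, by omega⟩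
  refine ⟨s, by simp; omega, S, ?_, T, ?_, fun i hi hiS => hT1 ?_⟩
  · refine Finset.mem_powersetCard.2 ⟨fun x hx => ?_, hs⟩
    simpa using hQm x (by simpa using hSQ hx)
  · exact Finset.mem_powersetCard.2 ⟨hT2, hT3.trans hs⟩
  · refine Finset.mem_image_of_mem _ (Finset.mem_filter.2 ⟨?_, hiS⟩)
    simpa [hlen] using hi

theorem sum_inv_two_pow_le (q : ℕ) : ∑ s ∈ Finset.range q, (2⁻¹ : ℝ≥0∞) ^ (s + 1) ≤ 1 := by
  refine (ENNReal.sum_le_tsum _).trans ?_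
  rw [ENNReal.tsum_geometric_add_one, ENNReal.one_sub_inv_two, inv_inv, ENNReal.inv_mul_cancel] <;>
    simp

/-- The union bound over all pairs of equal size. Each size leaves a factor 2^(-(s + 1)) to spare,
so the sum over sizes costs nothing. -/
theorem samples_not_isGood_le {n q lam : ℕ} (h : Admissible n q lam) :
    (samples (bucketBits q) (edges n lam)).toOuterMeasure {l | ¬ IsGood n q l} ≤ 2⁻¹ ^ lam := by
  obtain ⟨hq, hqn, hlam⟩ := h
  set μ := samples (bucketBits q) (edges n lam) with hμ
  set L := Nat.clog 2 n with hL
  have hnL : n ≤ 2 ^ L := Nat.le_pow_clog (by norm_num) n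
  have hbL : bucketBits q ≤ L + 2 := by
    refine Nat.clog_le_of_le_pow ?_
    rw [pow_add]
    omega
  calc μ.toOuterMeasure {l | ¬ IsGood n q l}
      ≤ μ.toOuterMeasure (⋃ s ∈ Finset.range q, ⋃ S ∈ (Finset.range n).powersetCard (s + 1),
          ⋃ T ∈ (Finset.range (2 ^ bucketBits q)).powersetCard (s + 1),
            {l | ∀ i < edges n lam, i % n ∈ S → l.getD i 0 ∈ T}) := by
        refine PMF.toOuterMeasure_mono _ ?_
        rintro l ⟨hl, hs⟩
        simp only [Set.mem_iUnion]
        obtain ⟨s, hs, S, hS, T, hT, h⟩ := exists_trapped hs hl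
        exact ⟨s, hs, S, hS, T, hT, h⟩
    _ ≤ ∑ s ∈ Finset.range q, ∑ S ∈ (Finset.range n).powersetCard (s + 1),
          ∑ T ∈ (Finset.range (2 ^ bucketBits q)).powersetCard (s + 1),
            (2⁻¹ : ℝ≥0∞) ^ (6 * (L + lam) * (s + 1)) := by
        refine (MeasureTheory.measure_biUnion_finset_le _ _).trans
          (Finset.sum_le_sum fun s hs => ?_)
        refine (MeasureTheory.measure_biUnion_finset_le _ _).trans
          (Finset.sum_le_sum fun S hS => ?_)
        refine (MeasureTheory.measure_biUnion_finset_le _ _).trans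
          (Finset.sum_le_sum fun T hT => ?_)
        rw [Finset.mem_powersetCard] at hS hT
        rw [Finset.mem_range] at hs
        have := samples_trapped_le (lam := lam) (q := q) hS.1 (hT.2.trans hS.2.symm) (by omega)
        rwa [hS.2] at this
    _ ≤ ∑ s ∈ Finset.range q, 2⁻¹ ^ lam * 2⁻¹ ^ (s + 1) := by
        refine Finset.sum_le_sum fun s _ => ?_
        rw [Finset.sum_const, Finset.sum_const, Finset.card_powersetCard,
          Finset.card_powersetCard, Finset.card_range, Finset.card_range, smul_smul,
          nsmul_eq_mul]
        -- There are at most 2^L items and 2^(L + 2) buckets to choose from.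
        have hc : n.choose (s + 1) * (2 ^ bucketBits q).choose (s + 1) ≤
            2 ^ ((2 * L + 2) * (s + 1)) := by
          calc _ ≤ n ^ (s + 1) * (2 ^ bucketBits q) ^ (s + 1) :=
                Nat.mul_le_mul (Nat.choose_le_pow _ _) (Nat.choose_le_pow _ _)
            _ ≤ (2 ^ L) ^ (s + 1) * (2 ^ (L + 2)) ^ (s + 1) := by
                gcongr
                norm_num
            _ = _ := by
                rw [← mul_pow, ← pow_add, ← pow_mul]
                congr 2
                ring
        have hc' : ((n.choose (s + 1) * (2 ^ bucketBits q).choose (s + 1) : ℕ) : ℝ≥0∞) ≤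
            2 ^ ((2 * L + 2) * (s + 1)) := by exact_mod_cast hc
        refine (mul_le_mul_left hc' _).trans ?_
        obtain ⟨c, hc⟩ : ∃ c, 6 * (L + lam) * (s + 1) =
            (2 * L + 2) * (s + 1) + (lam + (s + 1) + c) := by
          -- The difference of the exponents is (4L + 6 lam - 2)(s + 1) before subtracting lam + (s
          -- + 1); it suffices because lam ≥ 1.
          have hle : (2 * L + 2) * (s + 1) + (lam + (s + 1)) ≤ 6 * (L + lam) * (s + 1) := by
            nlinarith [Nat.zero_le (L * s), Nat.mul_le_mul_right s hlam]
          obtain ⟨c, hc⟩ := Nat.exists_eq_add_of_le hle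
          exact ⟨c, by omega⟩
        rw [hc, pow_add _ ((2 * L + 2) * (s + 1)), ← mul_assoc, ← mul_pow,
          ENNReal.mul_inv_cancel (by simp) (by simp), one_pow, one_mul, ← pow_add]
        exact pow_le_pow_right_of_le_one' (by simp) (by omega)
    _ ≤ 2⁻¹ ^ lam := by
        rw [← Finset.mul_sum]
        exact mul_le_of_le_one_right' (sum_inv_two_pow_le q)

/-! ## The batch code -/

/-- The batch code. -/
noncomputable def auctionCode : Code where
  initP := initProg
  encodeP := encodeProg
  scheduleP := scheduleProg
  decodeP := decodeProg
  -- The sum of the step bounds of `Schedule`, `Init`, `Encode` and `Decode`, in this order. With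
  -- `X` for `n + lam`, they use `q ≤ X`, `edges n lam ≤ 3 * X ^ 2` and `bucketBits q ≤ 4 * X`.
  time := 8 * .X * (.X + 2) * (3 * .X ^ 2 * 14 + 23) + 70 * .X + 25 +
    ((.X + 4 * .X) * 6 + 3 * .X ^ 2 * (4 * .X * 10 + 27) + 13) + (3 * .X ^ 2 * 6 + 1) +
    (.X * (3 * .X ^ 2 * 16 + 10) + 1)

/-! ### Step bounds and output distributions of the four algorithms. -/

theorem clock_auctionCode (n lam : ℕ) : auctionCode.clock n lam =
    8 * (n + lam) * ((n + lam) + 2) * (3 * (n + lam) ^ 2 * 14 + 23) + 70 * (n + lam) + 25 +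
    (((n + lam) + 4 * (n + lam)) * 6 + 3 * (n + lam) ^ 2 * (4 * (n + lam) * 10 + 27) + 13) +
    (3 * (n + lam) ^ 2 * 6 + 1) + ((n + lam) * (3 * (n + lam) ^ 2 * 16 + 10) + 1) := by
  simp [Code.clock, auctionCode]

theorem clog_le_self (n : ℕ) : Nat.clog 2 n ≤ n :=
  Nat.clog_le_of_le_pow Nat.lt_two_pow_self.le

/-- Half of the least power of two that is at least `4 * q` is below `4 * q`. -/
theorem bucket_count_lt {q : ℕ} (hq : 1 ≤ q) : 2 ^ bucketBits q < 8 * q := by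
  have h1 := Nat.pow_pred_clog_lt_self (by norm_num : 1 < 2) (by omega : 1 < 4 * q)
  have h2 : 0 < bucketBits q := Nat.clog_pos (by norm_num) (by omega)
  have h3 : 2 ^ bucketBits q = 2 ^ (bucketBits q).pred * 2 := by
    rw [← pow_succ, ← Nat.succ_eq_add_one, Nat.succ_pred_eq_of_pos h2]
  unfold bucketBits at *
  omega

theorem edges_le (n lam : ℕ) : edges n lam ≤ 3 * (n + lam) ^ 2 := by
  have := clog_le_self n
  calc edges n lam ≤ 3 * (n + lam) * (n + lam) := by
        unfold edges
        gcongr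
        omega
    _ = _ := by ring

theorem le_edges {n q lam : ℕ} (h : Admissible n q lam) : n ≤ edges n lam := by
  have := h.2.2
  unfold edges
  nlinarith [Nat.zero_le (n * Nat.clog 2 n), Nat.mul_le_mul_left n this]

theorem init_auctionCode {n q lam : ℕ} (h : Admissible n q lam) :
    auctionCode.init n q lam =
      (samples (bucketBits q) (edges n lam)).map fun l => some (table n l) := by
  obtain ⟨h1, h2, h3⟩ := h
  refine exec_initProg (by omega) q lam ?_
  have he := edges_le n lam
  have hb : bucketBits q ≤ 4 * (n + lam) := (clog_le_self _).trans (by omega)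
  have hc : Nat.clog 2 n + lam ≤ n + lam := by have := clog_le_self n; omega
  rw [clock_auctionCode]
  have : (Nat.clog 2 n + lam + bucketBits q) * 6 + edges n lam * (bucketBits q * 10 + 27) + 13 ≤
      ((n + lam) + 4 * (n + lam)) * 6 + 3 * (n + lam) ^ 2 * (4 * (n + lam) * 10 + 27) + 13 := by
    gcongr
  omega

theorem encode_auctionCode {n lam : ℕ} (q m : ℕ) {l DB : List ℕ}
    (hl : l.length = edges n lam) :
    auctionCode.encode n q lam m (table n l) DB =
      PMF.pure (some ((List.range m).map (bucket n l DB l.length))) := by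
  obtain ⟨s', hr, hs'⟩ := runs_encodeProg n l DB [n, q, lam]
  rw [Code.encode, show auctionCode.encodeP = encodeProg from rfl, exec_eq_pure hr]
  · simp [PMF.pure_map, hs']
  · have he := edges_le n lam
    rw [clock_auctionCode, hl]
    omega

theorem schedule_auctionCode {n q lam : ℕ} (h : Admissible n q lam) {l Q : List ℕ}
    (hl : l ∈ (samples (bucketBits q) (edges n lam)).support) (hQ : IsQuery n q Q) :
    ∃ H k cur, AuctionState l.length (2 ^ bucketBits q) (· % n) (fun i => l.getD i 0) Q
        (8 * q * (q + 2)) H k cur ∧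
      auctionCode.schedule n q lam (2 ^ bucketBits q) (table n l) Q =
        PMF.pure (some ((List.range (2 ^ bucketBits q)).map fun v => scheduled l (H v))) := by
  obtain ⟨hlen, hlt⟩ := mem_support_samples hl
  obtain ⟨s', H, k, cur, hr, ha, hs'⟩ := runs_scheduleProg (lam := lam) hQ hlt (fun x hx =>
    -- The edge with number `x` belongs to item `x`.
    ⟨x, by have := le_edges h; omega, Nat.mod_eq_of_lt hx⟩)
  refine ⟨H, k, cur, ha, ?_⟩
  rw [Code.schedule, show auctionCode.scheduleP = scheduleProg from rfl, exec_eq_pure hr]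
  · simp only [PMF.pure_map, Option.map_some]
    congr 2
    refine List.map_congr_left fun v hv => hs' v ?_
    rw [List.mem_range] at hv
    exact hv.trans (bucket_count_lt h.1)
  · have he := edges_le n lam
    have hq : q ≤ n + lam := by have := h.2.1; omega
    rw [clock_auctionCode, hlen]
    have : 8 * q * (q + 2) * (edges n lam * 14 + 23) + 70 * q + 25 ≤
        8 * (n + lam) * ((n + lam) + 2) * (3 * (n + lam) ^ 2 * 14 + 23) + 70 * (n + lam) + 25 := by
      gcongr
    exact Nat.le_add_right_of_le (Nat.le_add_right_of_le (Nat.le_add_right_of_le this))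

theorem decode_auctionCode {n q lam : ℕ} (h : Admissible n q lam) {l Q : List ℕ}
    (hl : l.length = edges n lam) (hQ : IsQuery n q Q) (S D : List (List ℕ)) (DB : List ℕ) :
    ∃ R, auctionCode.decode n q lam (table n l) Q S D = PMF.pure (some R) ∧
      ((∀ x ∈ Q, (∀ i < l.length, IsScheduled n l ([n, q, lam] :: table n l :: Q ::
            (List.zipWith (fun s d => [s, d]) S D).flatten) x i →
          (([n, q, lam] :: table n l :: Q :: (List.zipWith (fun s d => [s, d]) S D).flatten).getD
            (4 + l.getD i 0 + l.getD i 0) []).getD 0 0 = DB.getD x 0) ∧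
        (∃ i < l.length, IsScheduled n l ([n, q, lam] :: table n l :: Q ::
            (List.zipWith (fun s d => [s, d]) S D).flatten) x i)) → R = answers DB Q) := by
  obtain ⟨s', hr, hs'⟩ := runs_decodeProg (DB := DB) (inp := [n, q, lam] :: table n l :: Q ::
    (List.zipWith (fun s d => [s, d]) S D).flatten) rfl rfl rfl hQ.1
  refine ⟨s'.arr 0, ?_, hs'⟩
  rw [Code.decode, show auctionCode.decodeP = decodeProg from rfl, exec_eq_pure hr]
  · simp only [PMF.pure_map, Option.map_some]
  · have he := edges_le n lam
    have hq : q ≤ n + lam := by have := h.2.1; omega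
    rw [clock_auctionCode, hl]
    have : q * (edges n lam * 16 + 10) + 1 ≤
        (n + lam) * (3 * (n + lam) ^ 2 * 16 + 10) + 1 := by
      gcongr
    omega

theorem getD_flatten_zipWith (S D : List (List ℕ)) (h : S.length = D.length) (v : ℕ) :
    (List.zipWith (fun s d => [s, d]) S D).flatten.getD (v + v) [] = S.getD v [] ∧
    (List.zipWith (fun s d => [s, d]) S D).flatten.getD (v + v + 1) [] = D.getD v [] := by
  induction S generalizing D v with
  | nil =>
    obtain rfl : D = [] := List.length_eq_zero_iff.1 h.symm
    simp
  | cons s S ih =>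
    cases D with
    | nil => simp at h
    | cons d D =>
      cases v with
      | zero => simp
      | succ v =>
        have := ih D (by simpa using h) v
        have e : v + 1 + (v + 1) = v + v + 2 := by omega
        rw [e]
        simpa using this

/-! ### Systematic format, correctness on good tables, and robustness. -/

theorem scheduled_eq {l h : List ℕ} (hh : (scheduled l h).length ≠ 0) :
    ∃ e ∈ h, scheduled l h = [rank l e] := by
  rcases List.eq_nil_or_concat h with rfl | ⟨h', e, rfl⟩
  · simp [scheduled] at hh
  · exact ⟨e, by simp, by simp [scheduled]⟩

theorem getD_map_range (f : ℕ → List ℕ) {m v : ℕ} (hv : v < m) :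
    ((List.range m).map f).getD v [] = f v := by
  simp [List.getD_eq_getElem?_getD, hv]

theorem reads_map_range (f g : ℕ → List ℕ) (m : ℕ) :
    reads ((List.range m).map f) ((List.range m).map g) =
      (List.range m).map fun v => (f v).map fun j => (g v).getD j 0 := by
  simp [reads, List.zipWith_map, List.zipWith_self]

/-- This concerns every table that `Init` can produce, good or not: a bucket is read at the rank of
the last edge of its history, which is an existing position. -/
theorem isSystematic_auctionCode :
    auctionCode.IsSystematic (fun n _ lam => edges n lam) (fun _ q _ => 2 ^ bucketBits q) 1 := by
  intro n q lam h
  rw [init_auctionCode h]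
  constructor
  · simp [PMF.mem_support_map_iff]
  intro prms hprms DB Q hDB hQ
  rw [PMF.mem_support_map_iff] at hprms
  obtain ⟨l, hl, hp⟩ := hprms
  obtain rfl : table n l = prms := by simpa using hp
  have hlen := (mem_support_samples hl).1
  obtain ⟨H, k, cur, ha, hsch⟩ := schedule_auctionCode h hl hQ
  simp only [encode_auctionCode q _ hlen, hsch, PMF.mem_support_pure_iff, Option.some_inj]
  refine ⟨by simp, by simp, ?_, ?_, ?_⟩
  · rintro C rfl
    refine ⟨(sum_length_bucket_le ..).trans hlen.le, fun c hc x hx => ?_⟩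
    obtain ⟨v, -, rfl⟩ := List.mem_map.1 hc
    exact mem_of_mem_bucket (by have := h.1; have := h.2.1; omega) hDB hx
  · rintro S rfl s hs
    obtain ⟨v, -, rfl⟩ := List.mem_map.1 hs
    by_cases hh : (scheduled l (H v)).length = 0
    · simp [List.length_eq_zero_iff.1 hh]
    · obtain ⟨e, -, he⟩ := scheduled_eq hh
      simp [he]
  · rintro C S rfl rfl
    constructor
    · intro v hv j hj
      rw [getD_map_range _ hv] at hj ⊢
      obtain ⟨e, he, hs⟩ := scheduled_eq (List.length_pos_of_mem hj).ne'
      rw [hs, List.mem_singleton] at hj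
      obtain ⟨hel, rfl⟩ := ha.edge v e he
      rw [hj]
      exact rank_lt n DB hel
    · obtain ⟨R, hR, -⟩ := decode_auctionCode h hlen hQ
        ((List.range (2 ^ bucketBits q)).map fun v => scheduled l (H v))
        (reads ((List.range (2 ^ bucketBits q)).map fun v => scheduled l (H v))
          ((List.range (2 ^ bucketBits q)).map (bucket n l DB l.length))) DB
      rw [hR]
      simp

/-- After `Init` nothing is random. Every scheduled edge of an item carries the right word, and on a
good table each queried item has such an edge because the auction has assigned it. -/
theorem errs_auctionCode {n q lam : ℕ} (h : Admissible n q lam) {l DB Q : List ℕ}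
    (hl : l ∈ (samples (bucketBits q) (edges n lam)).support) (hgood : IsGood n q l)
    (hQ : IsQuery n q Q) :
    auctionCode.errs n q lam (2 ^ bucketBits q) (table n l) DB Q = PMF.pure false := by
  obtain ⟨hlen, hlt⟩ := mem_support_samples hl
  obtain ⟨H, k, cur, ha, hsch⟩ := schedule_auctionCode h hl hQ
  set S := (List.range (2 ^ bucketBits q)).map fun v => scheduled l (H v) with hS
  set C := (List.range (2 ^ bucketBits q)).map (bucket n l DB l.length) with hC
  obtain ⟨R, hR, hRans⟩ := decode_auctionCode h hlen hQ S (reads S C) DB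
  have hlV : ∀ i < l.length, l.getD i 0 < 2 ^ bucketBits q := fun i hi => by
    rw [List.getD_eq_getElem _ _ hi]
    exact hlt _ (List.getElem_mem _)
  have hin : ∀ v < 2 ^ bucketBits q,
      ([n, q, lam] :: table n l :: Q ::
        (List.zipWith (fun s d => [s, d]) S (reads S C)).flatten).getD (3 + v + v) [] =
          scheduled l (H v) ∧
      ([n, q, lam] :: table n l :: Q ::
        (List.zipWith (fun s d => [s, d]) S (reads S C)).flatten).getD (4 + v + v) [] =
          (scheduled l (H v)).map fun j => (bucket n l DB l.length v).getD j 0 := by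
    intro v hv
    have := getD_flatten_zipWith S (reads S C) (by simp [hS, hC, reads]) v
    have e1 : 3 + v + v = v + v + 1 + 1 + 1 := by omega
    have e2 : 4 + v + v = v + v + 1 + 1 + 1 + 1 := by omega
    rw [e1, e2, List.getD_cons_succ, List.getD_cons_succ, List.getD_cons_succ, this.1,
      List.getD_cons_succ, List.getD_cons_succ, List.getD_cons_succ, this.2, hS, hC,
      reads_map_range, getD_map_range _ hv, getD_map_range _ hv]
    exact ⟨rfl, rfl⟩
  have hans : R = answers DB Q := by
    refine hRans fun x hx => ⟨fun i hi hs => ?_, ?_⟩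
    · obtain ⟨hix, h1, h2⟩ := hs
      obtain ⟨e3, e4⟩ := hin _ (hlV i hi)
      rw [e3] at h1 h2
      obtain ⟨e, -, he⟩ := scheduled_eq h1
      rw [he] at h2
      have h2 : rank l e = rank l i := h2
      -- The matched edge `i` may be any edge whose rank is the scheduled position: the word there
      -- is the entry of the item of `i`, so uniqueness of the edge plays no role.
      rw [e4, he, h2, ← hix, ← bucket_getD_rank n DB hi]
      rfl
    · obtain ⟨v, hv⟩ := ha.exists_owner (hgood Q hQ) (by
        have hq := h.1
        have := bucket_count_lt h.1
        rw [hQ.1]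
        nlinarith [Nat.mul_le_mul_right (q + 1) this.le]) hx
      obtain ⟨e, he, hex⟩ := Option.map_eq_some_iff.1 hv
      obtain ⟨hel, hev⟩ := ha.edge v e (List.mem_of_getLast? he)
      have hsch : scheduled l (H v) = [rank l e] := by simp [scheduled, he]
      refine ⟨e, hel, hex, ?_⟩
      have := (hin _ (hlV e hel)).1
      rw [this]
      rw [show l.getD e 0 = v from hev, hsch]
      simp
  rw [Code.errs, encode_auctionCode q _ hlen, hsch, PMF.pure_bind, PMF.pure_bind]
  simp only [← hS, ← hC, hR, PMF.pure_map, hans]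
  simp

/-- A good table serves all queries, so a win of any adversary, chosen after seeing the table, lies
in the event that the table is not good. The two probabilities are compared table by table. -/
theorem isRobust_auctionCode :
    auctionCode.IsRobust (fun _ q _ => 2 ^ bucketBits q) fun lam => 2⁻¹ ^ lam := by
  intro A n q lam h
  refine le_trans ?_ (samples_not_isGood_le h)
  rw [Code.game, init_auctionCode h, PMF.bind_map, PMF.bind_apply, PMF.toOuterMeasure_apply]
  refine ENNReal.tsum_le_tsum fun l => ?_
  by_cases hl : l ∈ (samples (bucketBits q) (edges n lam)).support
  · by_cases hgood : IsGood n q l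
    · refine le_trans (le_of_eq ?_) zero_le
      rw [mul_eq_zero]
      right
      rw [PMF.apply_eq_zero_iff]
      simp only [Function.comp_apply, PMF.mem_support_bind_iff, not_exists, not_and]
      rintro (_ | ⟨DB, Q⟩) -
      · simp
      · simp only
        split_ifs with hval
        · rw [errs_auctionCode h hl hgood hval.2]
          simp
        · simp
    · rw [Set.indicator_of_mem (by exact hgood)]
      exact mul_le_of_le_one_right' (PMF.coe_le_one _ _)
  · rw [PMF.mem_support_iff, not_not] at hl
    simp [hl]

/-! ### The number of edges compared with `f`. -/

theorem clog_le_two_mul_log {n : ℕ} (hn : 1 ≤ n) :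
    (Nat.clog 2 n : ℝ) ≤ 2 * Real.log n + 1 := by
  rcases hn.lt_or_eq with hn | rfl
  · have h1 := Nat.pow_pred_clog_lt_self (by norm_num : 1 < 2) hn
    have h2 : ((2 : ℝ) ^ (Nat.clog 2 n).pred) ≤ n := by exact_mod_cast h1.le
    have h3 := Real.log_le_log (by positivity) h2
    rw [Real.log_pow] at h3
    have h4 : (Nat.clog 2 n : ℝ) ≤ (Nat.clog 2 n).pred + 1 := by
      exact_mod_cast Nat.le_succ_of_pred_le le_rfl
    -- The factor 2 works because log 2 exceeds 1/2.
    have h5 := Real.log_two_gt_d9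
    nlinarith [Nat.cast_nonneg (α := ℝ) (Nat.clog 2 n).pred]
  · simp

theorem exists_edges_le {f : ℕ → ℝ} (hf : ∀ n, 0 ≤ f n)
    (hlog : (fun n : ℕ => Real.log (n : ℝ)) =o[atTop] f) :
    ∃ CN : ℝ, ∀ n q lam : ℕ, Admissible n q lam →
      (edges n lam : ℝ) ≤ CN * ((n : ℝ) * (f n + (lam : ℝ))) := by
  obtain ⟨n₀, hn₀⟩ := eventually_atTop.1 (hlog.bound one_pos)
  -- From `n₀` on, log n is at most `f n`. Below `n₀` the logarithm is at most `n₀`, which is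
  -- absorbed by `n₀ * lam` since `lam ≥ 1`.
  refine ⟨3 * (n₀ + 2), fun n q lam ⟨h1, h2, h3⟩ => ?_⟩
  have hlam : (1 : ℝ) ≤ lam := by exact_mod_cast h3
  have hfn := hf n
  have key : (Nat.clog 2 n : ℝ) ≤ 2 * f n + (n₀ + 1) * lam := by
    have hn₀' : (0 : ℝ) ≤ n₀ := by positivity
    rcases le_total n₀ n with hn | hn
    · have h := hn₀ n hn
      rw [one_mul, Real.norm_of_nonneg hfn] at h
      have := clog_le_two_mul_log (by omega : 1 ≤ n)
      have := (Real.le_norm_self _).trans h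
      nlinarith
    · have : (Nat.clog 2 n : ℝ) ≤ n₀ := by exact_mod_cast (clog_le_self n).trans hn
      nlinarith
  have : (Nat.clog 2 n : ℝ) + lam ≤ (n₀ + 2) * (f n + lam) := by
    nlinarith [mul_nonneg (Nat.cast_nonneg (α := ℝ) n₀) hfn]
  calc (edges n lam : ℝ) = 3 * n * (Nat.clog 2 n + lam) := by
        simp [edges]
    _ ≤ 3 * n * ((n₀ + 2) * (f n + lam)) := by gcongr
    _ = _ := by ring

end RobustPBC

theorem mainTheorem10 :
    ∃ Cb : ℕ, ∀ f : ℕ → ℝ, (∀ n, 0 ≤ f n) →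
      (fun n : ℕ => Real.log (n : ℝ)) =o[atTop] f →
      ∃ (CN : ℝ) (P : RobustPBC.Code) (N b : ℕ → ℕ → ℕ → ℕ),
        P.IsSystematic N b 1 ∧
        P.IsRobust b (fun lam => (2 : ℝ≥0∞)⁻¹ ^ lam) ∧
        ∀ n q lam : ℕ, RobustPBC.Admissible n q lam →
          b n q lam ≤ Cb * q ∧
          (N n q lam : ℝ) ≤ CN * ((n : ℝ) * (f n + (lam : ℝ))) := by
  refine ⟨8, fun f hf hlog => ?_⟩
  obtain ⟨CN, hCN⟩ := RobustPBC.exists_edges_le hf hlog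
  exact ⟨CN, RobustPBC.auctionCode, _, _, RobustPBC.isSystematic_auctionCode,
    RobustPBC.isRobust_auctionCode, fun n q lam h =>
      ⟨(RobustPBC.bucket_count_lt h.1).le, hCN n q lam h⟩⟩
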